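/- Strings are finite binary strings, and $\log$ is the binary logarithm. A prefix Turing machine has a read-only one-way input tape that initially holds an infinite binary sequence, one or more work tapes that are infinite to the right, over a finite alphabet, and a write-only one-way output tape. If it halts, its program $p$ is the scanned segment of the input tape (including the square under the head), $T(p)$ is the content of the output tape, and $\mathrm{time}(p)$ is the number of steps. Let $U$ be an optimal prefix Turing machine, that is, for every prefix Turing machine $T$ there is a string $i$ such that $U(ip)=T(p)$ for all $p$ (with both sides undefined for the same $p$). Put \[K(x)=\min\{|p|:U(p)=x\},\qquad BB(n)=\max\{\mathrm{time}(p): |p|\le n,\ U(p)\text{ halts}\}\] (with $\max\emptyset=0$), and let the logical depth of $x$ at significance $b\in\mathbb N$ be \[\mathrm{depth}_b(x)=\min\{\mathrm{time}(p): |p|\le K(p)+b,\ U(p)=x\}.\] Call $c\in\mathbb N$ admissible if every string $x$ has a program $p$ of length $K(x)$ with $|p|\le K(p)+c$; then $\mathrm{depth}_b(x)$ is defined for all strings $x$ and all $b\ge c$. Admissible constants exist. Moreover, there is an infinite sequence of strings $x_1,x_2,\dots$ with $|x_{m+1}|=|x_m|+1$ for all $m$ such that the following holds for every admissible $c$. For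 every $m$ the maximal gap \[h(m)=\max_{i\ge c}\bigl(\mathrm{depth}_i(x_m)-\mathrm{depth}_{i+1}(x_m)\bigr)\] exists and is attained at some $i=i_{m,\max}$ with $c\le i_{m,\max}<|x_m|-K(x_m)+O(\log|x_m|)$. The function $h$ rises faster than any computable function: for every computable $f:\mathbb N\to\mathbb N$ we have $h(m)>f(m)$ for all but finitely many $m$. Nevertheless $h(m)\le BB(|x_m|+O(\log|x_m|))$ for all $m$. The constants in the $O$-terms do not depend on $m$. -/

import Mathlib

/-- Moves of a work tape head. -/
inductive HeadMove where
  | left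
  | stay
  | right

/-- A work tape that is infinite to the right only: `before` lists the squares to the left of the
head (nearest first, so it is empty when the head is on the leftmost square), `head` is the scanned
symbol and `after` lists the squares to the right of the head; all further squares are blank. -/
structure WorkTape (Γ : Type) where
  before : List Γ
  head : Γ
  after : List Γ

namespace WorkTape

/-- The tape all of whose squares hold the symbol `blank`, with the head on the leftmost square. -/
def empty {Γ : Type} (blank : Γ) : WorkTape Γ := ⟨[], blank, []⟩

/-- Replace the scanned symbol. -/
def write {Γ : Type} (a : Γ) (T : WorkTape Γ) : WorkTape Γ := ⟨T.before, a, T.after⟩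

/-- Move the head; a head on the leftmost square stays there when told to move left. -/
def move {Γ : Type} (blank : Γ) : HeadMove → WorkTape Γ → WorkTape Γ
  | .stay, T => T
  | .right, T => ⟨T.head :: T.before, T.after.headD blank, T.after.tail⟩
  | .left, ⟨[], a, r⟩ => ⟨[], a, r⟩
  | .left, ⟨b :: l, a, r⟩ => ⟨l, b, a :: r⟩

end WorkTape

/-- What a machine with `k` work tapes does in one step: the next state, whether the head of the
one-way input tape advances, the symbols written on the work tapes, the moves of the work tape
heads, and the bit (if any) written on the one-way output tape. -/
structure StepAction (State Γ : Type) (k : ℕ) where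
  next : State
  advance : Bool
  write : Fin k → Γ
  move : Fin k → HeadMove
  emit : Option Bool

/-- A prefix Turing machine: finitely many states, a read-only one-way input tape holding an
infinite binary sequence, `extraTapes + 1` work tapes over a finite alphabet, and a write-only
one-way binary output tape. The machine halts when its transition function returns `none`. -/
structure PrefixTM where
  State : Type
  [finState : Finite State]
  Γ : Type
  [finΓ : Finite Γ]
  blank : Γ
  start : State
  extraTapes : ℕ
  δ : State → Bool → (Fin (extraTapes + 1) → Γ) → Option (StepAction State Γ (extraTapes + 1))

namespace PrefixTM

/-- A configuration; the output is listed in the order in which it was written. -/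
structure Cfg (M : PrefixTM) where
  state : M.State
  inputPos : ℕ
  work : Fin (M.extraTapes + 1) → WorkTape M.Γ
  output : List Bool

/-- All heads on the leftmost squares, work tapes and output tape empty. -/
def initCfg (M : PrefixTM) : M.Cfg where
  state := M.start
  inputPos := 0
  work := fun _ => WorkTape.empty M.blank
  output := []

/-- One step on the input sequence `ω`; `none` if the machine has halted. -/
def step (M : PrefixTM) (ω : ℕ → Bool) (c : M.Cfg) : Option M.Cfg :=
  (M.δ c.state (ω c.inputPos) (fun j => (c.work j).head)).map fun a =>
    { state := a.next
      inputPos := if a.advance then c.inputPos + 1 else c.inputPos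
      work := fun j => ((c.work j).write (a.write j)).move M.blank (a.move j)
      output := c.output ++ a.emit.toList }

/-- The configuration after exactly `t` steps on the input sequence `ω`; `none` if the machine
halted earlier. -/
def run (M : PrefixTM) (ω : ℕ → Bool) : ℕ → Option M.Cfg
  | 0 => some M.initCfg
  | t + 1 => (M.run ω t).bind (M.step ω)

/-- `M.Halts p y t`: the machine `M` halts after exactly `t` steps, the segment of the input tape
that it scanned (the square under the head at the end included) is `p`, and its output is `y`.
The squares behind `p` are filled with `false`; this is immaterial, since they are not scanned. -/
def Halts (M : PrefixTM) (p y : List Bool) (t : ℕ) : Prop :=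
  ∃ c : M.Cfg, M.run (fun i => p.getD i false) t = some c ∧
    M.step (fun i => p.getD i false) c = none ∧
    c.inputPos + 1 = p.length ∧ c.output = y

/-- `M(p) = y`. -/
def Computes (M : PrefixTM) (p y : List Bool) : Prop := ∃ t, M.Halts p y t

/-- `U` is an optimal prefix Turing machine: every prefix Turing machine `T` has an index `i`
such that `U(ip) = T(p)` for all `p` (both sides undefined for the same `p`). -/
def IsOptimal (U : PrefixTM) : Prop :=
  ∀ T : PrefixTM, ∃ i : List Bool, ∀ p y : List Bool, U.Computes (i ++ p) y ↔ T.Computes p y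

/-- Prefix-free Kolmogorov complexity with respect to `U`. -/
noncomputable def K (U : PrefixTM) (x : List Bool) : ℕ :=
  sInf {n | ∃ p : List Bool, U.Computes p x ∧ p.length = n}

/-- The running times of the `b`-incompressible programs for `x`. -/
def depthTimes (U : PrefixTM) (b : ℕ) (x : List Bool) : Set ℕ :=
  {t | ∃ p : List Bool, p.length ≤ U.K p + b ∧ U.Halts p x t}

/-- The logical depth of `x` at significance `b`, meaningful if `U.depthTimes b x` is nonempty. -/
noncomputable def depth (U : PrefixTM) (b : ℕ) (x : List Bool) : ℕ := sInf (U.depthTimes b x)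

/-- The Busy Beaver function: the longest running time of a halting program of length at
most `n`. -/
noncomputable def BB (U : PrefixTM) (n : ℕ) : ℕ :=
  sSup {t | ∃ p y : List Bool, p.length ≤ n ∧ U.Halts p y t}

/-- Every string has a shortest program that is `c`-incompressible. In this case the logical depth
at every significance `b ≥ c` is defined for all strings, and it is at most the running time of
such a program. -/
def ShortestIncompressible (U : PrefixTM) (c : ℕ) : Prop :=
  ∀ x : List Bool, ∃ p : List Bool, U.Computes p x ∧ p.length = U.K x ∧ p.length ≤ U.K p + c

end PrefixTM

/-! Put `n = m + 2` and let `T = slowBound n` be the largest number for which the pair `(n, T)` has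
complexity at most `n / 2`. For computable `f` the pair `(n, f n)` has complexity `O(log n)`, so `T`
eventually dominates every computable function of `n`. The string `x_m` is the first one of length
`n` that is produced within `T` steps on at most a fraction `2 ^ (-n)` of the inputs (`slowString`);
averaging over all strings of length `n` shows that it exists.

From `(n, T)` one can compute `x_m` and all its programs that halt within `T` steps. Their total
weight is at most `2 ^ (-n)`, so a Shannon–Fano code describes such a program `p` by `|p| - n +
O(1)` further bits (`IsOptimal.K_fast_le`). Hence `K(p) ≤ |p| - n/2 + O(1)`, and for large `n` no
such `p` is `c`-incompressible: the depth at significance `c` exceeds `T`.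

On the other hand, the program that contains `x_m` literally has length `n + O(log n)`, complexity
at least `K(x_m) - O(1)`, and a running time below a computable `g n`. So the depth is at most `g n`
from significance `n - K(x_m) + O(log n)` on. It falls from above `T` to at most `g n` within `n +
O(log n)` steps, so the largest drop outgrows every computable function. Past the threshold every
drop is at most `g n`, which locates the largest one. No drop exceeds the running time of a shortest
`c`-incompressible program, whose length is at most `n + O(log n)`; this is the Busy Beaver bound.

Optimality speaks of concrete tape machines, so self-delimiting decoders given as partial recursive
functions have to be realised by prefix machines (`PrefixTM.exists_of_partrec`), and runs of prefix
machines have to be shown computable (`PrefixTM.primrec_snapshot`). Both together give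
`IsOptimal.exists_index`, on which all upper bounds for complexity rest. -/

open Turing Turing.PartrecToTM2

/-! ### Prefix machines that interpret stack programs -/

/-- The control states of the interactive machine outside the interpreted stack program. -/
inductive Ctl where
  | start
  | putEnd
  | grow
  | putLead
  | ready
  | store
  | check
  | out
  | skip
  | stuck

instance : Finite Ctl :=
  Finite.of_injective
    (fun s : Ctl => (Ctl.rec 0 1 2 3 4 5 6 7 8 9 s : Fin 10))
    (by intro a b h; cases a <;> cases b <;> first | rfl | (exact absurd h (by decide)))

namespace Interactive

abbrev StackStmt := TM2.Stmt (fun _ : K' => Γ') Λ' (Option Γ')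

abbrev Heads := Fin (3 + 1) → Option Γ'

abbrev Stacks := K' → List Γ'

def prog : Λ' → StackStmt := tr

/-- The work tape that holds a stack. -/
def tapeOf : K' → Fin (3 + 1)
  | .main => 0
  | .rev => 1
  | .aux => 2
  | .stack => 3

theorem tapeOf_injective : Function.Injective tapeOf := by
  intro a b h
  cases a <;> cases b <;> first | rfl | (simp [tapeOf] at h)

/-- The statements of the stack program for `c`. -/
abbrev Node (c : ToPartrec.Code) : Type :=
  {q : Option StackStmt // q ∈ TM2.stmts prog (codeSupp c Cont'.halt)}

abbrev State (c : ToPartrec.Code) : Type := Ctl ⊕ (Node c × Option Γ' × Bool)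

-- A prefix machine has finitely many states, so only statements in the finite support of the
-- program qualify. The runs considered below never leave the support.
open scoped Classical in
noncomputable def node (c : ToPartrec.Code) (q : StackStmt) (v : Option Γ') (pending : Bool) :
    State c :=
  if h : some q ∈ TM2.stmts prog (codeSupp c Cont'.halt) then .inr (⟨some q, h⟩, v, pending)
  else .inl .stuck

abbrev Act (c : ToPartrec.Code) := StepAction (State c) (Option Γ') (3 + 1)

/-- Write `a` on the tape of stack `k` and move its head by `m`; the other tapes are unchanged. -/
def actOn {c : ToPartrec.Code} (h : Heads) (k : K') (a : Option Γ') (m : HeadMove)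
    (next : State c) (advance : Bool := false) (emit : Option Bool := none) : Act c where
  next := next
  advance := advance
  write := fun j => if j = tapeOf k then a else h j
  move := fun j => if j = tapeOf k then m else .stay
  emit := emit

/-- The symbol for an input bit. -/
def bitSym (b : Bool) : Γ' := if b then .bit1 else .bit0

/-- A push takes two steps, since an action writes before it moves: first the head goes right, and
`pending` remembers that the symbol is still to be written. -/
noncomputable def stmtAct (c : ToPartrec.Code) (v : Option Γ') (pending : Bool) (h : Heads) :
    StackStmt → Act c
  | .push k f q =>
    if pending then actOn h k (some (f v)) .stay (node c q v false)
    else actOn h k (h (tapeOf k)) .right (node c (.push k f q) v true)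
  | .peek k f q => actOn h k (h (tapeOf k)) .stay (node c q (f v (h (tapeOf k))) false)
  | .pop k f q => actOn h k (h (tapeOf k)) .left (node c q (f v (h (tapeOf k))) false)
  | .load a q => actOn h .main (h 0) .stay (node c q (a v) false)
  | .branch f q₁ q₂ => actOn h .main (h 0) .stay (node c (bif f v then q₁ else q₂) v false)
  | .goto l => actOn h .main (h 0) .stay (node c (prog (l v)) v false)
  | .halt => actOn h .main (h 0) .stay (.inl .check)

/-- After each run of the stack program, `check` inspects the lowest digit of the result: 0 advances
the input head for another round, 1 starts the output. The output ends when the list terminator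
`cons` is on top. -/
noncomputable def trans (c : ToPartrec.Code) : State c → Bool → Heads → Option (Act c)
  | .inl .start, _, h => some (actOn h .main (h 0) .right (.inl .putEnd))
  | .inl .putEnd, _, h => some (actOn h .main (some .cons) .stay (.inl .grow))
  | .inl .grow, _, h => some (actOn h .main (h 0) .right (.inl .putLead))
  | .inl .putLead, _, h => some (actOn h .main (some .bit1) .stay (.inl .ready))
  | .inl .ready, _, h => some (actOn h .main (h 0) .right (.inl .store))
  | .inl .store, b, h =>
    some (actOn h .main (some (bitSym b)) .stay (node c (prog (trNormal c Cont'.halt)) none false))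
  | .inl .check, _, h =>
    match h 0 with
    | some .bit0 => some (actOn h .main (h 0) .left (.inl .ready) true)
    | some .bit1 => some (actOn h .main (h 0) .left (.inl .out))
    | _ => none
  | .inl .out, _, h =>
    match h 0 with
    | some .bit0 => some (actOn h .main (h 0) .left (.inl .skip) false (some false))
    | some .bit1 => some (actOn h .main (h 0) .left (.inl .skip) false (some true))
    | _ => none
  | .inl .skip, _, h => some (actOn h .main (h 0) .left (.inl .out))
  | .inl .stuck, _, _ => none
  | .inr (⟨none, _⟩, _, _), _, _ => none
  | .inr (⟨some q, _⟩, v, pending), _, h => some (stmtAct c v pending h q)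

/-- The machine that reads one bit at a time and runs the stack program for `c` on the bits read
so far, until the program tells it to write its output and to halt. -/
noncomputable abbrev machine (c : ToPartrec.Code) : PrefixTM where
  State := State c
  Γ := Option Γ'
  blank := none
  start := .inl .start
  extraTapes := 3
  δ := trans c

/-- The tape holds the stack `S`, with its top under the head. -/
def Holds (T : WorkTape (Option Γ')) (S : List Γ') : Prop :=
  T.head :: T.before = S.map some ++ [none]

theorem Holds.head {T : WorkTape (Option Γ')} {S : List Γ'} (h : Holds T S) :
    T.head = S.head? := by
  cases S with
  | nil => simp [Holds] at h; simp [h]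
  | cons a S => simp [Holds] at h; simp [h]

/-- Squares to the right of the head are unconstrained, so a popped symbol need not be erased. On an
empty stack the head is on the leftmost square and stays there, in accordance with `[].tail = []`.
-/
theorem Holds.pop {T : WorkTape (Option Γ')} {S : List Γ'} (h : Holds T S) :
    Holds ((T.write T.head).move none .left) S.tail := by
  rcases T with ⟨l, a, r⟩
  cases S with
  | nil =>
    simp [Holds] at h
    obtain ⟨rfl, rfl⟩ := h
    simp [Holds, WorkTape.write, WorkTape.move]
  | cons b S =>
    simp only [Holds, List.map_cons, List.cons_append, List.cons.injEq] at h
    obtain ⟨rfl, rfl⟩ := h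
    cases S <;> simp [Holds, WorkTape.write, WorkTape.move]

theorem Holds.push {T : WorkTape (Option Γ')} {S : List Γ'} (h : Holds T S) (a : Γ') :
    Holds ((((T.write T.head).move none .right).write (some a)).move none .stay) (a :: S) := by
  simpa [Holds, WorkTape.write, WorkTape.move] using h

/-- The configuration has the given state, input position and output, and its work tapes hold the
given stacks. -/
structure Sim {c : ToPartrec.Code} (s : State c) (i : ℕ) (S : Stacks) (o : List Bool)
    (C : (machine c).Cfg) : Prop where
  state : C.state = s
  pos : C.inputPos = i
  out : C.output = o
  holds : ∀ k, Holds (C.work (tapeOf k)) (S k)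

/-- From the first description the machine gets to the second one. -/
def Goes {c : ToPartrec.Code} (ω : ℕ → Bool) (s : State c) (i : ℕ) (S : Stacks) (o : List Bool)
    (s' : State c) (i' : ℕ) (S' : Stacks) (o' : List Bool) : Prop :=
  ∀ C, Sim s i S o C → ∃ C', Sim s' i' S' o' C' ∧
    Relation.ReflTransGen (fun a b => (machine c).step ω a = some b) C C'

theorem Goes.refl {c : ToPartrec.Code} {ω : ℕ → Bool} {s : State c} {i : ℕ} {S : Stacks}
    {o : List Bool} : Goes ω s i S o s i S o :=
  fun C h => ⟨C, h, .refl⟩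

theorem Goes.trans {c : ToPartrec.Code} {ω : ℕ → Bool} {s₁ s₂ s₃ : State c} {i₁ i₂ i₃ : ℕ}
    {S₁ S₂ S₃ : Stacks} {o₁ o₂ o₃ : List Bool} (h : Goes ω s₁ i₁ S₁ o₁ s₂ i₂ S₂ o₂)
    (h' : Goes ω s₂ i₂ S₂ o₂ s₃ i₃ S₃ o₃) : Goes ω s₁ i₁ S₁ o₁ s₃ i₃ S₃ o₃ := by
  intro C hC
  obtain ⟨C₂, hC₂, r₂⟩ := h C hC
  obtain ⟨C₃, hC₃, r₃⟩ := h' C₂ hC₂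
  exact ⟨C₃, hC₃, r₂.trans r₃⟩

theorem step_actOn {c : ToPartrec.Code} {ω : ℕ → Bool} {C : (machine c).Cfg} {k : K'}
    {a : Option Γ'} {m : HeadMove} {next : State c} {advance : Bool} {emit : Option Bool}
    (h : trans c C.state (ω C.inputPos) (fun j => (C.work j).head) =
      some (actOn (fun j => (C.work j).head) k a m next advance emit)) :
    (machine c).step ω C = some
      { state := next
        inputPos := if advance then C.inputPos + 1 else C.inputPos
        work := Function.update C.work (tapeOf k)
          (((C.work (tapeOf k)).write a).move (none : Option Γ') m)
        output := C.output ++ emit.toList } := by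
  unfold PrefixTM.step
  change Option.map _ (trans c C.state (ω C.inputPos) (fun j => (C.work j).head)) = _
  rw [h]
  simp only [Option.map_some, Option.some.injEq, actOn, PrefixTM.Cfg.mk.injEq, true_and, and_true]
  funext j
  by_cases hj : j = tapeOf k
  · subst hj; simp
  · simp [hj]; rfl

theorem update_holds {W : Fin (3 + 1) → WorkTape (Option Γ')} {S : Stacks}
    (h : ∀ k, Holds (W (tapeOf k)) (S k)) (k : K') {T : WorkTape (Option Γ')} {L : List Γ'}
    (hT : Holds T L) (k' : K') :
    Holds (Function.update W (tapeOf k) T (tapeOf k')) (Function.update S k L k') := by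
  by_cases hk : k' = k
  · subst hk; simpa using hT
  · rw [Function.update_of_ne (fun e => hk (tapeOf_injective e)), Function.update_of_ne hk]
    exact h k'

theorem Sim.top {c : ToPartrec.Code} {s : State c} {i : ℕ} {S : Stacks} {o : List Bool}
    {C : (machine c).Cfg} (h : Sim s i S o C) (k : K') :
    (C.work (tapeOf k)).head = (S k).head? := (h.holds k).head

theorem goes_pop {c : ToPartrec.Code} {ω : ℕ → Bool} {s next : State c} {i : ℕ} {S : Stacks}
    {o : List Bool} (k : K') {advance : Bool} {emit : Option Bool}
    (hs : ∀ h : Heads, (∀ k, h (tapeOf k) = (S k).head?) →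
      trans c s (ω i) h = some (actOn h k (h (tapeOf k)) .left next advance emit)) :
    Goes ω s i S o next (if advance then i + 1 else i) (Function.update S k (S k).tail)
      (o ++ emit.toList) := by
  intro C hC
  have h := step_actOn (ω := ω) (C := C) (k := k) (by
    rw [hC.state, hC.pos]; exact hs _ hC.top)
  refine ⟨_, ⟨rfl, ?_, ?_, ?_⟩, .single h⟩
  · simp [hC.pos]
  · simp [hC.out]
  · exact update_holds hC.holds k (hC.holds k).pop

theorem goes_stay {c : ToPartrec.Code} {ω : ℕ → Bool} {s next : State c} {i : ℕ} {S : Stacks}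
    {o : List Bool} (k : K')
    (hs : ∀ h : Heads, (∀ k, h (tapeOf k) = (S k).head?) →
      trans c s (ω i) h = some (actOn h k (h (tapeOf k)) .stay next)) :
    Goes ω s i S o next i S o := by
  intro C hC
  have h := step_actOn (ω := ω) (C := C) (k := k) (by
    rw [hC.state, hC.pos]; exact hs _ hC.top)
  refine ⟨_, ⟨rfl, ?_, ?_, ?_⟩, .single h⟩
  · simp [hC.pos]
  · simp [hC.out]
  · have := update_holds hC.holds k (hC.holds k)
    rw [Function.update_eq_self, Function.update_eq_self] at this
    simpa [WorkTape.write, WorkTape.move] using this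

theorem goes_push {c : ToPartrec.Code} {ω : ℕ → Bool} {s s' next : State c} {i : ℕ} {S : Stacks}
    {o : List Bool} (k : K') (a : Γ')
    (hs : ∀ h : Heads, trans c s (ω i) h = some (actOn h k (h (tapeOf k)) .right s'))
    (hs' : ∀ h : Heads, trans c s' (ω i) h = some (actOn h k (some a) .stay next)) :
    Goes ω s i S o next i (Function.update S k (a :: S k)) o := by
  intro C hC
  have h₁ := step_actOn (ω := ω) (C := C) (k := k) (by
    rw [hC.state, hC.pos]; exact hs _)
  obtain ⟨D, hD⟩ : ∃ D, (machine c).step ω C = some D := ⟨_, h₁⟩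
  have hD' := Option.some.inj (hD.symm.trans h₁)
  have h₂ := step_actOn (ω := ω) (C := D) (k := k) (by
    rw [hD']; simpa [hC.pos] using hs' _)
  refine ⟨_, ?_, .tail (.single hD) h₂⟩
  refine ⟨rfl, ?_, ?_, ?_⟩
  all_goals subst hD'
  · simp [hC.pos]
  · simp [hC.out]
  · simp only [Function.update_idem, Function.update_self]
    exact update_holds hC.holds k ((hC.holds k).push a)

theorem trans_node {c : ToPartrec.Code} {q : StackStmt} {v : Option Γ'} {pending : Bool}
    (hq : some q ∈ TM2.stmts prog (codeSupp c Cont'.halt)) (b : Bool) (h : Heads) :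
    trans c (node c q v pending) b h = some (stmtAct c v pending h q) := by
  simp [node, hq, trans]

theorem mem_stmts_of_label {c : ToPartrec.Code} {l : Λ'} (h : l ∈ codeSupp c Cont'.halt) :
    some (prog l) ∈ TM2.stmts prog (codeSupp c Cont'.halt) := by
  classical
  simp only [TM2.stmts, Finset.mem_insertNone, Finset.mem_biUnion, Option.mem_def,
    Option.some.injEq, forall_eq']
  exact ⟨l, h, TM2.stmts₁_self⟩

/-- The control state that corresponds to a label of the stack program. -/
noncomputable def after (c : ToPartrec.Code) (l : Option Λ') (v : Option Γ') : State c :=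
  l.elim (.inl .check) fun l => node c (prog l) v false

theorem goes_stmt {c : ToPartrec.Code} {ω : ℕ → Bool} {i : ℕ} {o : List Bool} (q : StackStmt)
    (hq : some q ∈ TM2.stmts prog (codeSupp c Cont'.halt)) (v : Option Γ') (S : Stacks) :
    Goes ω (node c q v false) i S o
      (after c (TM2.stepAux q v S).l (TM2.stepAux q v S).var) i (TM2.stepAux q v S).stk o := by
  classical
  have sub : ∀ {q'}, q' ∈ TM2.stmts₁ q → some q' ∈ TM2.stmts prog (codeSupp c Cont'.halt) :=
    fun h => TM2.stmts_trans h hq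
  induction q generalizing v S with
  | push k f q ih =>
    have hq' := sub (q' := q) (by simp [TM2.stmts₁, TM2.stmts₁_self])
    refine Goes.trans (goes_push k (f v) (s' := node c (.push k f q) v true)
      (next := node c q v false) (fun h => ?_) (fun h => ?_))
      (ih hq' _ _ fun h => TM2.stmts_trans h hq')
    · rw [trans_node hq]; simp [stmtAct]
    · rw [trans_node hq]; simp [stmtAct]
  | peek k f q ih =>
    have hq' := sub (q' := q) (by simp [TM2.stmts₁, TM2.stmts₁_self])
    refine Goes.trans (goes_stay k (next := node c q (f v (S k).head?) false) (fun h hh => ?_))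
      (ih hq' _ _ fun h => TM2.stmts_trans h hq')
    rw [trans_node hq]; simp [stmtAct, hh]
  | pop k f q ih =>
    have hq' := sub (q' := q) (by simp [TM2.stmts₁, TM2.stmts₁_self])
    have := goes_pop (ω := ω) (s := node c (.pop k f q) v false) (i := i) (S := S) (o := o) k
      (advance := false) (emit := none)
      (next := node c q (f v (S k).head?) false) (fun h hh => by
        rw [trans_node hq]; simp [stmtAct, hh])
    simp only [Bool.false_eq_true, if_false, Option.toList_none, List.append_nil] at this
    exact this.trans (ih hq' _ _ fun h => TM2.stmts_trans h hq')
  | load a q ih =>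
    have hq' := sub (q' := q) (by simp [TM2.stmts₁, TM2.stmts₁_self])
    refine Goes.trans (goes_stay .main (next := node c q (a v) false) (fun h hh => ?_))
      (ih hq' _ _ fun h => TM2.stmts_trans h hq')
    rw [trans_node hq]; rfl
  | branch f q₁ q₂ ih₁ ih₂ =>
    have hq₁ := sub (q' := q₁) (by simp [TM2.stmts₁, TM2.stmts₁_self])
    have hq₂ := sub (q' := q₂) (by simp [TM2.stmts₁, TM2.stmts₁_self])
    refine Goes.trans (goes_stay .main (next := node c (bif f v then q₁ else q₂) v false)
      (fun h hh => ?_)) ?_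
    · rw [trans_node hq]; rfl
    · cases hf : f v
      · simpa [hf] using ih₂ hq₂ v S fun h => TM2.stmts_trans h hq₂
      · simpa [hf] using ih₁ hq₁ v S fun h => TM2.stmts_trans h hq₁
  | goto l =>
    refine goes_stay .main (fun h hh => ?_)
    rw [trans_node hq]; rfl
  | halt =>
    refine goes_stay .main (fun h hh => ?_)
    rw [trans_node hq]; rfl

/-- Each step of the stack machine is a finite sequence of tape steps, and labels stay in the finite
support. -/
theorem goes_reaches {c : ToPartrec.Code} {ω : ℕ → Bool} {i : ℕ} {o : List Bool}
    {a b : TM2.Cfg (fun _ : K' => Γ') Λ' (Option Γ')}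
    (h : StateTransition.Reaches (TM2.step prog) a b)
    (ha : a.l ∈ Finset.insertNone (codeSupp c Cont'.halt)) :
    Goes ω (after c a.l a.var) i a.stk o (after c b.l b.var) i b.stk o := by
  let _ : Inhabited Λ' := ⟨trNormal c Cont'.halt⟩
  induction h using Relation.ReflTransGen.head_induction_on with
  | refl => exact Goes.refl
  | head h _ ih =>
    rename_i a d _
    refine Goes.trans ?_ (ih (TM2.step_supports prog (tr_supports c Cont'.halt) h ha))
    rcases a with ⟨_ | l, v, S⟩
    · simp at h
    · simp only [TM2.step, Option.mem_def, Option.some.injEq] at h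
      subst h
      exact goes_stmt _ (mem_stmts_of_label (by simpa using ha)) v S

end Interactive

/-! ### Coding of input and output in the rounds of the machine -/

namespace Interactive

/-- The digits are stored with the lowest one on top, so pushing a bit maps `n` to `2 * n + b`. Zero
is excluded because its code is the empty word. -/
theorem trNat_bit (b : Bool) {n : ℕ} (h : 2 * n + b.toNat ≠ 0) :
    trNat (2 * n + b.toNat) = bitSym b :: trNat n := by
  have e : 2 * n + b.toNat = Nat.bit b n := by cases b <;> simp [Nat.bit_val]
  rw [e] at h ⊢
  simp only [trNat, ← Num.ofNat'_eq]
  rw [Num.ofNat'_bit]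
  cases b
  · have hn : n ≠ 0 := by rintro rfl; simp at h
    rw [Num.ofNat'_eq]
    cases hm : (n : Num) with
    | zero =>
      exfalso; apply hn
      have : ((n : Num) : ℕ) = 0 := by rw [hm]; rfl
      simpa using this
    | pos m => rfl
  · cases hm : Num.ofNat' n <;> rfl

/-- The number whose binary digits are the given ones behind a leading `1`. -/
def leadVal (p : List Bool) : ℕ := p.foldl (fun n b => 2 * n + b.toNat) 1

theorem leadVal_concat (p : List Bool) (b : Bool) :
    leadVal (p ++ [b]) = 2 * leadVal p + b.toNat := by
  simp [leadVal]

theorem leadVal_pos (p : List Bool) : 0 < leadVal p := by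
  induction p using List.reverseRecOn with
  | nil => simp [leadVal]
  | append_singleton p b ih => rw [leadVal_concat]; omega

theorem leadVal_injective : Function.Injective leadVal := by
  intro p
  induction p using List.reverseRecOn with
  | nil =>
    intro q h
    rcases List.eq_nil_or_concat q with rfl | ⟨q, b, rfl⟩
    · rfl
    · have := leadVal_pos q
      rw [List.concat_eq_append, leadVal_concat] at h
      simp [leadVal] at h
      unfold leadVal at this; omega
  | append_singleton p b ih =>
    intro q h
    rcases List.eq_nil_or_concat q with rfl | ⟨q, b', rfl⟩
    · have := leadVal_pos p
      rw [leadVal_concat] at h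
      simp [leadVal] at h
      unfold leadVal at this; omega
    · rw [List.concat_eq_append, leadVal_concat, leadVal_concat] at h
      have hb : b = b' := by cases b <;> cases b' <;> simp at h ⊢ <;> omega
      subst hb
      rw [ih (by omega : leadVal p = leadVal q), List.concat_eq_append]

/-- An encoding of strings in which every bit is followed by a digit `1`. -/
def markVal (y : List Bool) : ℕ := y.foldr (fun b n => 2 * (2 * n + 1) + b.toNat) 0

/-- The result of one round: an even number asks for another input bit, an odd number holds the
output. -/
def resultVal (n : ℕ) : Option (List Bool) → ℕ
  | none => 2 * n
  | some y => 2 * markVal y + 1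

/-- The program works on numbers. It returns its own input, doubled, when it wants another bit: so
the bits read so far survive the round on the main stack. -/
theorem exists_round {G : List Bool →. Option (List Bool)} (hG : Partrec G) :
    ∃ c : ToPartrec.Code, ∀ p r, r ∈ G p →
      [resultVal (leadVal p) r] ∈ c.eval [leadVal p] := by
  have hlead : Computable leadVal := by
    refine Primrec.to_comp (Primrec.list_foldl (h := fun _ (a : ℕ × Bool) => 2 * a.1 + a.2.toNat)
      Primrec.id (Primrec.const 1) ?_)
    exact Primrec.nat_add.comp (Primrec.nat_mul.comp (Primrec.const 2) (Primrec.fst.comp Primrec.snd))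
      ((Primrec.dom_finite Bool.toNat).comp (Primrec.snd.comp Primrec.snd))
  have hmark : Computable markVal := by
    refine Primrec.to_comp (Primrec.list_foldr
      (h := fun _ (a : Bool × ℕ) => 2 * (2 * a.2 + 1) + a.1.toNat) Primrec.id (Primrec.const 0) ?_)
    refine Primrec.nat_add.comp (Primrec.nat_mul.comp (Primrec.const 2) (Primrec.succ.comp
      (Primrec.nat_mul.comp (Primrec.const 2) (Primrec.snd.comp Primrec.snd))))
      ((Primrec.dom_finite Bool.toNat).comp (Primrec.fst.comp Primrec.snd))
  have hres : Computable₂ resultVal := by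
    refine (Computable.option_casesOn (o := fun a : ℕ × Option (List Bool) => a.2)
      (f := fun a => 2 * a.1) (g := fun _ y => 2 * markVal y + 1) Computable.snd
      (Primrec.nat_double.to_comp.comp Computable.fst)
      (Primrec.nat_double_succ.to_comp.comp (hmark.comp Computable.snd))).of_eq ?_
    rintro ⟨n, _ | y⟩ <;> rfl
  -- `leadVal` is inverted by unbounded search; injectivity makes the result unique.
  let parse : ℕ → ℕ → Option (List Bool) := fun n e =>
    (Encodable.decode e).bind fun p : List Bool => if leadVal p = n then some p else none
  have hparse : Computable₂ parse := by
    refine Computable.option_bind (Computable.decode.comp Computable.snd) ?_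
    have : Computable₂ fun (a : ℕ × ℕ) (p : List Bool) => decide (leadVal p = a.1) :=
      (Primrec.eq (α := ℕ)).decide.to_comp.comp (hlead.comp Computable.snd)
        (Computable.fst.comp Computable.fst)
    refine (Computable.cond this (Computable.option_some.comp Computable.snd)
      (Computable.const none)).of_eq fun a => ?_
    by_cases h : leadVal a.2 = a.1.1 <;> simp [h]
  let f : ℕ →. ℕ := fun n => (Nat.rfindOpt (parse n)).bind fun p => (G p).map (resultVal n)
  have hf : Partrec f := by
    refine (Partrec.rfindOpt hparse).bind ?_
    exact (hG.comp Computable.snd).map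
      (hres.comp (Computable.fst.comp Computable.fst) Computable.snd)
  have hval : ∀ p, Nat.rfindOpt (parse (leadVal p)) = Part.some p := by
    intro p
    refine Part.eq_some_iff.2 ?_
    have hd : (Nat.rfindOpt (parse (leadVal p))).Dom :=
      Nat.rfindOpt_dom.2 ⟨Encodable.encode p, p, by simp [parse]⟩
    obtain ⟨q, hq⟩ := Part.dom_iff_mem.1 hd
    obtain ⟨e, he⟩ := Nat.rfindOpt_spec hq
    simp only [parse, Option.mem_def, Option.bind_eq_some_iff] at he
    obtain ⟨q', -, h⟩ := he
    split_ifs at h with hh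
    cases h
    exact leadVal_injective hh ▸ hq
  obtain ⟨c, hc⟩ := ToPartrec.Code.exists_code (Nat.Partrec'.part_iff₁.2 hf)
  refine ⟨c, fun p r hr => ?_⟩
  have := hc ⟨[leadVal p], rfl⟩
  change c.eval [leadVal p] = pure <$> f (leadVal p) at this
  rw [this]
  simp only [f, hval, Part.bind_some, Part.map_eq_map, Part.mem_map_iff]
  exact ⟨_, ⟨r, hr, rfl⟩, rfl⟩

/-- All stacks but the main one are empty. -/
def mainOnly (L : List Γ') : Stacks := K'.elim L [] [] []

theorem mainOnly_main (L : List Γ') : mainOnly L .main = L := rfl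

theorem update_mainOnly (L L' : List Γ') :
    Function.update (mainOnly L) .main L' = mainOnly L' := by
  simp [mainOnly]

variable {c : ToPartrec.Code} {ω : ℕ → Bool}

theorem goes_start : Goes (c := c) ω (.inl .start) 0 (mainOnly []) []
    (.inl .ready) 0 (mainOnly (trNat (leadVal []) ++ [.cons])) [] := by
  have h₁ : Goes (c := c) ω (.inl .start) 0 (mainOnly []) [] (.inl .grow) 0 _ [] :=
    goes_push .main .cons (s' := .inl .putEnd) (fun _ => rfl) (fun _ => rfl)
  have h₂ : Goes (c := c) ω (.inl .grow) 0 (mainOnly [.cons]) [] (.inl .ready) 0 _ [] :=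
    goes_push .main .bit1 (s' := .inl .putLead) (fun _ => rfl) (fun _ => rfl)
  rw [update_mainOnly] at h₁ h₂
  exact h₁.trans h₂

theorem goes_round {G : List Bool →. Option (List Bool)}
    (hc : ∀ p r, r ∈ G p → [resultVal (leadVal p) r] ∈ c.eval [leadVal p])
    {p : List Bool} {i : ℕ} {r : Option (List Bool)} (hr : r ∈ G (p ++ [ω i])) :
    Goes (c := c) ω (.inl .ready) i (mainOnly (trNat (leadVal p) ++ [.cons])) []
      (.inl .check) i
      (mainOnly (trNat (resultVal (leadVal (p ++ [ω i])) r) ++ [.cons])) [] := by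
  have h₁ : Goes (c := c) ω (.inl .ready) i (mainOnly (trNat (leadVal p) ++ [.cons])) []
      (node c (prog (trNormal c Cont'.halt)) none false) i _ [] :=
    goes_push .main (bitSym (ω i)) (s' := .inl .store) (fun _ => rfl) (fun _ => rfl)
  rw [update_mainOnly, mainOnly_main, ← List.cons_append, ← trNat_bit, ← leadVal_concat] at h₁
  · have h₂ := hc _ _ hr
    have h₃ := tr_eval c [leadVal (p ++ [ω i])]
    have h₄ : halt [resultVal (leadVal (p ++ [ω i])) r] ∈
        StateTransition.eval (TM2.step tr) (init c [leadVal (p ++ [ω i])]) := by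
      rw [h₃]
      exact Part.mem_map _ h₂
    have h₅ := (StateTransition.mem_eval.1 h₄).1
    exact h₁.trans (goes_reaches (c := c) (ω := ω) (i := i) (o := []) h₅
      (Finset.some_mem_insertNone.2 (tr_supports c Cont'.halt).1))
  · rw [← leadVal_concat]; exact (leadVal_pos _).ne'

/-- The marker digits 1 in `markVal` keep zeros of the output from being lost as leading zeros;
`skip` removes them. -/
theorem goes_out (i : ℕ) (y o : List Bool) :
    Goes (c := c) ω (.inl .out) i (mainOnly (trNat (markVal y) ++ [.cons])) o
      (.inl .out) i (mainOnly [.cons]) (o ++ y) := by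
  induction y generalizing o with
  | nil => simpa [markVal] using Goes.refl
  | cons b y ih =>
    have e : trNat (markVal (b :: y)) = bitSym b :: .bit1 :: trNat (markVal y) := by
      change trNat (2 * (2 * markVal y + 1) + b.toNat) = _
      rw [trNat_bit b (by omega)]
      exact congrArg _ (trNat_bit true (n := markVal y) (by simp))
    have h₁ := goes_pop (c := c) (ω := ω) (s := .inl .out) (next := .inl .skip) (i := i)
      (S := mainOnly (trNat (markVal (b :: y)) ++ [.cons])) (o := o) .main (advance := false)
      (emit := some b) (fun h hh => by
        have := hh .main
        rw [mainOnly_main, e] at this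
        change h 0 = _ at this
        cases b <;> simp [trans, this, bitSym, tapeOf])
    have h₂ := goes_pop (c := c) (ω := ω) (s := .inl .skip) (next := .inl .out) (i := i)
      (S := mainOnly (.bit1 :: trNat (markVal y) ++ [.cons])) (o := o ++ [b]) .main
      (advance := false) (emit := none) (fun h hh => rfl)
    rw [update_mainOnly, mainOnly_main, e] at h₁
    rw [update_mainOnly, mainOnly_main] at h₂
    rw [e]
    simp only [Bool.false_eq_true, if_false, Option.toList_none, List.append_nil] at h₂
    have := h₁.trans (h₂.trans (ih (o ++ [b])))
    simpa using this

end Interactive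

open Interactive in
/-- A partial recursive function that, given the bits read so far, says whether to read another bit
or what to output is carried out by a prefix machine. -/
theorem PrefixTM.exists_of_partrec {G : List Bool →. Option (List Bool)} (hG : Partrec G) :
    ∃ T : PrefixTM, ∀ p y : List Bool, p ≠ [] → some y ∈ G p →
      (∀ q, q ≠ [] → q <+: p → q ≠ p → none ∈ G q) → T.Computes p y := by
  obtain ⟨c, hc⟩ := exists_round hG
  refine ⟨machine c, fun p y hp hy hpre => ?_⟩
  set ω : ℕ → Bool := fun i => p.getD i false with hω
  -- Invariant of the reading phase: when square `j` is about to be processed, the main stack holds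
  -- the number that codes the first `j` bits.
  have hread : ∀ j, j < p.length → Goes (c := c) ω (.inl .start) 0 (mainOnly []) []
      (.inl .ready) j (mainOnly (trNat (leadVal (p.take j)) ++ [.cons])) [] := by
    intro j
    induction j with
    | zero => intro _; simpa using goes_start
    | succ j ih =>
      intro hj
      have e : p.take (j + 1) = p.take j ++ [ω j] := by
        rw [List.take_add_one, hω]
        simp [List.getElem?_eq_getElem (by omega : j < p.length)]
      refine (ih (by omega)).trans ?_
      have hn : none ∈ G (p.take j ++ [ω j]) := by
        rw [← e]
        refine hpre _ ?_ (List.take_prefix _ _) ?_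
        · intro h; have := congrArg List.length h; rw [List.length_take, List.length_nil] at this; omega
        · intro h; have := congrArg List.length h; rw [List.length_take] at this; omega
      refine (goes_round hc hn).trans ?_
      rw [← e]
      have hne := leadVal_pos (p.take (j + 1))
      have e' : trNat (resultVal (leadVal (p.take (j + 1))) none) =
          .bit0 :: trNat (leadVal (p.take (j + 1))) :=
        trNat_bit false (by simp; omega)
      have h := goes_pop (c := c) (ω := ω) (s := .inl .check) (next := .inl .ready) (i := j)
        (S := mainOnly (trNat (resultVal (leadVal (p.take (j + 1))) none) ++ [.cons])) (o := [])
        .main (advance := true) (emit := none) (fun h hh => by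
          have := hh .main
          rw [mainOnly_main, e'] at this
          change h 0 = _ at this
          simp [Interactive.trans, this, tapeOf])
      rw [update_mainOnly, mainOnly_main, e'] at h
      rw [e']
      simpa using h
  have hlen : 0 < p.length := List.length_pos_of_ne_nil hp
  obtain ⟨j, hj⟩ : ∃ j, p.length = j + 1 := ⟨p.length - 1, by omega⟩
  have e : p = p.take j ++ [ω j] := by
    have : p.take (j + 1) = p.take j ++ [ω j] := by
      rw [List.take_add_one, hω]
      simp [List.getElem?_eq_getElem (by omega : j < p.length)]
    rw [← this, ← hj, List.take_length]
  have h₁ := goes_round (ω := ω) hc (p := p.take j) (i := j) (r := some y) (by rw [← e]; exact hy)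
  rw [← e] at h₁
  have e' : trNat (resultVal (leadVal p) (some y)) = .bit1 :: trNat (markVal y) :=
    trNat_bit true (by simp)
  have h₂ := goes_pop (c := c) (ω := ω) (s := .inl .check) (next := .inl .out) (i := j)
    (S := mainOnly (trNat (resultVal (leadVal p) (some y)) ++ [.cons])) (o := [])
    .main (advance := false) (emit := none) (fun h hh => by
      have := hh .main
      rw [mainOnly_main, e'] at this
      change h 0 = _ at this
      simp [Interactive.trans, this, tapeOf])
  rw [update_mainOnly, mainOnly_main, e'] at h₂
  rw [e'] at h₁
  simp only [Bool.false_eq_true, if_false, Option.toList_none, List.append_nil, List.cons_append,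
    List.tail_cons] at h₁ h₂
  have h := (hread j (by omega)).trans (h₁.trans (h₂.trans (goes_out j y [])))
  obtain ⟨C, hC, hreach⟩ := h (machine c).initCfg ⟨rfl, rfl, rfl, fun k => by
    cases k <;> simp [PrefixTM.initCfg, Holds, WorkTape.empty, mainOnly]⟩
  obtain ⟨t, ht⟩ : ∃ t, (machine c).run ω t = some C := by
    clear hC
    induction hreach with
    | refl => exact ⟨0, rfl⟩
    | tail _ hs ih =>
      obtain ⟨t, ht⟩ := ih
      exact ⟨t + 1, by rw [PrefixTM.run, ht]; exact hs⟩
  refine ⟨t, C, ht, ?_, ?_, ?_⟩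
  · have := hC.top .main
    change (C.work 0).head = _ at this
    unfold PrefixTM.step
    change Option.map _ (Interactive.trans c C.state _ _) = none
    rw [hC.state]
    simp [Interactive.trans, this, mainOnly_main]
  · rw [hC.pos, hj]
  · simpa using hC.out

/-! ### Runs of a prefix machine are primitive recursive -/

theorem Primrec.of_finite_left {δ α β : Type*} [Finite δ] [Primcodable δ] [Primcodable α]
    [Primcodable β] {F : δ → α → β} (h : ∀ d, Primrec (F d)) : Primrec₂ F := by
  obtain ⟨n, ⟨e⟩⟩ := Finite.exists_equiv_fin δ
  have h₁ : Primrec₂ fun (i : Fin n) (a : α) => F (e.symm i) a :=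
    Primrec.fin_curry₁.2 fun i => h _
  exact (h₁.comp ((Primrec.dom_finite e).comp Primrec.fst) Primrec.snd).of_eq (by simp)

def WorkTape.equivProd (Γ : Type) : WorkTape Γ ≃ List Γ × Γ × List Γ where
  toFun T := (T.before, T.head, T.after)
  invFun T := ⟨T.1, T.2.1, T.2.2⟩

instance WorkTape.primcodable (Γ : Type) [Primcodable Γ] : Primcodable (WorkTape Γ) :=
  Primcodable.ofEquiv _ (WorkTape.equivProd Γ)

namespace WorkTape

variable {Γ α : Type} [Primcodable Γ] [Primcodable α]

theorem primrec_equivProd : Primrec (WorkTape.equivProd Γ) := Primrec.of_equiv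

theorem primrec_head : Primrec (WorkTape.head : WorkTape Γ → Γ) :=
  Primrec.fst.comp (Primrec.snd.comp primrec_equivProd)

theorem primrec_before : Primrec (WorkTape.before : WorkTape Γ → List Γ) :=
  Primrec.fst.comp primrec_equivProd

theorem primrec_after : Primrec (WorkTape.after : WorkTape Γ → List Γ) :=
  Primrec.snd.comp (Primrec.snd.comp primrec_equivProd)

theorem primrec_mk {l r : α → List Γ} {a : α → Γ} (hl : Primrec l) (ha : Primrec a)
    (hr : Primrec r) : Primrec fun x => WorkTape.mk (l x) (a x) (r x) :=
  (Primrec.of_equiv_symm (e := WorkTape.equivProd Γ)).comp (hl.pair (ha.pair hr))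

theorem primrec_write (a : Γ) : Primrec (WorkTape.write a) :=
  primrec_mk primrec_before (Primrec.const a) primrec_after

theorem primrec_move (blank : Γ) (m : HeadMove) : Primrec (WorkTape.move blank m) := by
  cases m with
  | stay => exact Primrec.id.of_eq fun T => by simp [WorkTape.move]
  | right =>
    refine (primrec_mk (Primrec.list_cons.comp primrec_head primrec_before)
      (Primrec.option_getD.comp (Primrec.list_head?.comp primrec_after) (Primrec.const blank))
      (Primrec.list_tail.comp primrec_after)).of_eq fun T => ?_
    simp [WorkTape.move, List.headD_eq_head?_getD]
  | left =>
    refine (Primrec.list_casesOn (f := WorkTape.before)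
      (g := id) (h := fun T bl => ⟨bl.2, bl.1, T.head :: T.after⟩)
      primrec_before Primrec.id (primrec_mk (Primrec.snd.comp Primrec.snd)
        (Primrec.fst.comp Primrec.snd)
        (Primrec.list_cons.comp (primrec_head.comp Primrec.fst)
          (primrec_after.comp Primrec.fst)))).of_eq fun T => ?_
    rcases T with ⟨_ | ⟨b, l⟩, a, r⟩ <;> rfl

end WorkTape

namespace PrefixTM

def Cfg.equivProd (M : PrefixTM) :
    M.Cfg ≃ M.State × ℕ × (Fin (M.extraTapes + 1) → WorkTape M.Γ) × List Bool where
  toFun C := (C.state, C.inputPos, C.work, C.output)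
  invFun C := ⟨C.1, C.2.1, C.2.2.1, C.2.2.2⟩

variable (M : PrefixTM) [Primcodable M.State] [Primcodable M.Γ]

instance Cfg.primcodable : Primcodable M.Cfg := Primcodable.ofEquiv _ (Cfg.equivProd M)

variable {M}

theorem Cfg.primrec_equivProd : Primrec (Cfg.equivProd M) := Primrec.of_equiv

theorem Cfg.primrec_state : Primrec (Cfg.state : M.Cfg → _) :=
  Primrec.fst.comp primrec_equivProd

theorem Cfg.primrec_inputPos : Primrec (Cfg.inputPos : M.Cfg → _) :=
  Primrec.fst.comp (Primrec.snd.comp primrec_equivProd)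

theorem Cfg.primrec_work : Primrec (Cfg.work : M.Cfg → _) :=
  Primrec.fst.comp (Primrec.snd.comp (Primrec.snd.comp primrec_equivProd))

theorem Cfg.primrec_output : Primrec (Cfg.output : M.Cfg → _) :=
  Primrec.snd.comp (Primrec.snd.comp (Primrec.snd.comp primrec_equivProd))

theorem primrec_act
    (s : M.State) (adv : Bool) (w : Fin (M.extraTapes + 1) → M.Γ)
    (m : Fin (M.extraTapes + 1) → HeadMove) (e : List Bool) :
    Primrec fun C : M.Cfg =>
      ({ state := s
         inputPos := if adv then C.inputPos + 1 else C.inputPos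
         work := fun j => ((C.work j).write (w j)).move M.blank (m j)
         output := C.output ++ e } : M.Cfg) := by
  refine (Primrec.of_equiv_symm (e := Cfg.equivProd M)).comp
    ((Primrec.const s).pair (Primrec.pair ?_ (Primrec.pair ?_ ?_)))
  · cases adv
    · exact Cfg.primrec_inputPos
    · exact Primrec.succ.comp Cfg.primrec_inputPos
  · refine Primrec.fin_curry.2 (Primrec₂.swap (Primrec.fin_curry₁.2 fun j => ?_))
    exact (WorkTape.primrec_move _ _).comp ((WorkTape.primrec_write _).comp
      (Primrec.fin_app.comp Cfg.primrec_work (Primrec.const j)))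
  · exact Primrec.list_append.comp Cfg.primrec_output (Primrec.const e)

/-- The action depends only on state, input bit and scanned symbols, which range over a finite set;
for each of their values the update of the configuration is a fixed primitive recursive map. -/
theorem primrec_step :
    Primrec₂ fun (p : List Bool) (C : M.Cfg) => M.step (fun i => p.getD i false) C := by
  have := M.finState
  have := M.finΓ
  let F : M.State × Bool × (Fin (M.extraTapes + 1) → M.Γ) → M.Cfg → Option M.Cfg := fun d C =>
    (M.δ d.1 d.2.1 d.2.2).map fun a =>
    { state := a.next
      inputPos := if a.advance then C.inputPos + 1 else C.inputPos
      work := fun j => ((C.work j).write (a.write j)).move M.blank (a.move j)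
      output := C.output ++ a.emit.toList }
  have hF : Primrec₂ F := Primrec.of_finite_left fun d => by
    cases hd : M.δ d.1 d.2.1 d.2.2 with
    | none => simpa [F, hd] using Primrec.const none
    | some a => simpa [F, hd] using Primrec.option_some.comp (primrec_act _ _ _ _ _)
  refine hF.comp (Primrec.pair (Cfg.primrec_state.comp Primrec.snd) (Primrec.pair ?_ ?_))
    Primrec.snd
  · exact (Primrec.list_getD false).comp Primrec.fst (Cfg.primrec_inputPos.comp Primrec.snd)
  · refine Primrec.fin_curry.2 (Primrec₂.swap (Primrec.fin_curry₁.2 fun j => ?_))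
    exact WorkTape.primrec_head.comp
      (Primrec.fin_app.comp (Cfg.primrec_work.comp Primrec.snd) (Primrec.const j))

theorem primrec_run :
    Primrec₂ fun (p : List Bool) (t : ℕ) => M.run (fun i => p.getD i false) t := by
  refine (Primrec.nat_rec (f := fun _ => some M.initCfg)
    (g := fun (p : List Bool) (a : ℕ × Option M.Cfg) =>
      a.2.bind (M.step (fun i => p.getD i false))) (Primrec.const _) ?_).of_eq ?_
  · exact Primrec.option_bind (Primrec.snd.comp Primrec.snd)
      (primrec_step.comp (Primrec.fst.comp Primrec.fst) Primrec.snd)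
  · rintro p t
    induction t with
    | zero => rfl
    | succ t ih => simp only [run]; rw [← ih]

end PrefixTM

/-! ### Halting on prefixes, and an optimal machine that runs itself -/

namespace PrefixTM

/-- The input sequence that starts with `p` and continues with `false`. -/
abbrev pad (p : List Bool) : ℕ → Bool := fun i => p.getD i false

variable {M : PrefixTM}

theorem run_mono {ω : ℕ → Bool} {t t' : ℕ} (h : t ≤ t') {C' : M.Cfg} (hC' : M.run ω t' = some C') :
    ∃ C, M.run ω t = some C ∧ C.inputPos ≤ C'.inputPos := by
  induction h generalizing C' with
  | refl => exact ⟨C', hC', le_rfl⟩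
  | step h ih =>
    simp only [run, Option.bind_eq_some_iff] at hC'
    obtain ⟨D, hD, hs⟩ := hC'
    obtain ⟨C, hC, hle⟩ := ih hD
    refine ⟨C, hC, hle.trans ?_⟩
    simp only [step, Option.map_eq_some_iff] at hs
    obtain ⟨a, -, rfl⟩ := hs
    dsimp only
    split_ifs
    exacts [Nat.le_succ _, le_rfl]

theorem step_congr {ω ω' : ℕ → Bool} {C : M.Cfg} (h : ω C.inputPos = ω' C.inputPos) :
    M.step ω C = M.step ω' C := by
  simp only [step, h]

/-- The input head never moves back, so its final position bounds all squares scanned. -/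
theorem run_congr {ω ω' : ℕ → Bool} {t : ℕ} {C : M.Cfg} (hC : M.run ω t = some C)
    (h : ∀ i, i ≤ C.inputPos → ω i = ω' i) : M.run ω' t = some C := by
  induction t generalizing C with
  | zero => exact hC
  | succ t ih =>
    obtain ⟨D, hD, hle⟩ := run_mono (Nat.le_succ t) hC
    simp only [run, hD, Option.bind_some] at hC
    simp only [run, ih hD fun i hi => h i (hi.trans hle), Option.bind_some]
    rw [← step_congr (h _ hle), hC]

theorem run_step_ne_none {ω : ℕ → Bool} {t t' : ℕ} (h : t < t') {C C' : M.Cfg}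
    (hC : M.run ω t = some C) (hC' : M.run ω t' = some C') : M.step ω C ≠ none := by
  obtain ⟨D, hD, -⟩ := run_mono (Nat.succ_le_of_lt h) hC'
  simp only [run, hC, Option.bind_some] at hD
  simp [hD]

theorem pad_append {q r : List Bool} {i : ℕ} (h : i < q.length) : pad (q ++ r) i = pad q i := by
  simp [pad, List.getD_eq_getElem?_getD, List.getElem?_append_left h]

/-- Input position, whether the machine has halted, and output after exactly `t` steps. -/
noncomputable def snapshot (M : PrefixTM) (p : List Bool) (t : ℕ) :
    Option (ℕ × Bool × List Bool) :=
  (M.run (pad p) t).map fun C => (C.inputPos, (M.step (pad p) C).isNone, C.output)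

/-- Codings of states and symbols are chosen inside the proof; they do not occur in the type of
`snapshot`. -/
theorem primrec_snapshot (M : PrefixTM) : Primrec₂ M.snapshot := by
  obtain ⟨n, ⟨e⟩⟩ := @Finite.exists_equiv_fin M.State M.finState
  obtain ⟨m, ⟨f⟩⟩ := @Finite.exists_equiv_fin M.Γ M.finΓ
  let _ : Primcodable M.State := Primcodable.ofEquiv _ e
  let _ : Primcodable M.Γ := Primcodable.ofEquiv _ f
  refine Primrec.option_map primrec_run (Primrec.pair ?_ (Primrec.pair ?_ ?_))
  · exact Cfg.primrec_inputPos.comp Primrec.snd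
  · have h : Primrec fun a : (List Bool × ℕ) × M.Cfg => M.step (pad a.1.1) a.2 :=
      primrec_step.comp (Primrec.fst.comp Primrec.fst) Primrec.snd
    refine (Primrec.not.comp (Primrec.option_isSome.comp h)).of_eq fun a => ?_
    simp
  · exact Cfg.primrec_output.comp Primrec.snd

/-- If the machine has halted after exactly `t` steps: the length of the scanned segment, and the
output. -/
noncomputable def haltAt (M : PrefixTM) (p : List Bool) (t : ℕ) : Option (ℕ × List Bool) :=
  (M.snapshot p t).bind fun s => if s.2.1 then some (s.1 + 1, s.2.2) else none

theorem primrec_haltAt (M : PrefixTM) : Primrec₂ M.haltAt := by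
  refine Primrec.option_bind M.primrec_snapshot ?_
  have h : Primrec fun a : (List Bool × ℕ) × ℕ × Bool × List Bool => a.2.2.1 :=
    Primrec.fst.comp (Primrec.snd.comp Primrec.snd)
  refine (Primrec.cond h (Primrec.option_some.comp (Primrec.pair (Primrec.succ.comp
    (Primrec.fst.comp Primrec.snd)) (Primrec.snd.comp (Primrec.snd.comp Primrec.snd))))
    (Primrec.const none)).of_eq fun ⟨_, _, b, _⟩ => ?_
  cases b <;> rfl

theorem haltAt_eq_some {s y : List Bool} {t n : ℕ} : M.haltAt s t = some (n, y) ↔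
    ∃ C, M.run (pad s) t = some C ∧ M.step (pad s) C = none ∧ C.inputPos + 1 = n ∧
      C.output = y := by
  simp only [haltAt, snapshot, Option.bind_eq_some_iff, Option.map_eq_some_iff]
  constructor
  · rintro ⟨_, ⟨C, hC, rfl⟩, h⟩
    split_ifs at h with hs
    simp only [Option.some.injEq, Prod.mk.injEq] at h
    exact ⟨C, hC, by simpa using hs, h.1, h.2⟩
  · rintro ⟨C, hC, hs, rfl, rfl⟩
    exact ⟨_, ⟨C, hC, rfl⟩, by simp [hs]⟩

theorem haltAt_iff_halts {p y : List Bool} {t : ℕ} :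
    M.haltAt p t = some (p.length, y) ↔ M.Halts p y t :=
  haltAt_eq_some

theorem haltAt_append {p y r : List Bool} {t : ℕ} (h : M.Halts p y t) :
    M.haltAt (p ++ r) t = some (p.length, y) := by
  obtain ⟨C, hC, hs, hp, rfl⟩ := h
  refine haltAt_eq_some.2 ⟨C, ?_, ?_, hp, rfl⟩
  · exact run_congr hC fun i hi => (pad_append (by omega)).symm
  · rw [← hs]
    exact step_congr (pad_append (by omega))

theorem haltAt_unique {s : List Bool} {t t' : ℕ} {a a' : ℕ × List Bool}
    (h : M.haltAt s t = some a) (h' : M.haltAt s t' = some a') : t = t' ∧ a = a' := by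
  obtain ⟨C, hC, hs, h₁, h₂⟩ := haltAt_eq_some.1 h
  obtain ⟨C', hC', hs', h₁', h₂'⟩ := haltAt_eq_some.1 h'
  rcases lt_trichotomy t t' with hlt | rfl | hlt
  · exact absurd hs (run_step_ne_none hlt hC hC')
  · rw [h] at h'; exact ⟨rfl, Option.some.inj h'⟩
  · exact absurd hs' (run_step_ne_none hlt hC' hC)

theorem Halts.unique {p y y' : List Bool} {t t' : ℕ} (h : M.Halts p y t) (h' : M.Halts p y' t') :
    t = t' ∧ y = y' := by
  obtain ⟨h₁, h₂⟩ := haltAt_unique (haltAt_iff_halts.2 h) (haltAt_iff_halts.2 h')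
  exact ⟨h₁, (Prod.mk.inj h₂).2⟩

theorem Computes.unique {p y y' : List Bool} (h : M.Computes p y) (h' : M.Computes p y') :
    y = y' :=
  (h.choose_spec.unique h'.choose_spec).2

theorem Computes.ne_nil {p y : List Bool} (h : M.Computes p y) : p ≠ [] := by
  obtain ⟨t, C, -, -, h, -⟩ := h
  rintro rfl
  simp at h

theorem mem_rfindOpt_of_unique {α : Type*} {f : ℕ → Option α} {a : α} {n : ℕ} (h : f n = some a)
    (h' : ∀ m b, f m = some b → b = a) : a ∈ Nat.rfindOpt f := by
  obtain ⟨b, hb⟩ := Part.dom_iff_mem.1 (Nat.rfindOpt_dom.2 ⟨n, a, h⟩)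
  obtain ⟨m, hm⟩ := Nat.rfindOpt_spec hb
  rwa [h' m b hm] at hb

/-- Whether within `t` steps the machine scans more than `p` (the inner value is `none` then) or
halts; in the second case its output and the rest of the input. -/
noncomputable def parse (M : PrefixTM) (p : List Bool) (t : ℕ) :
    Option (Option (List Bool × List Bool)) :=
  (M.snapshot p t).bind fun s =>
    if p.length ≤ s.1 then some none
    else if s.2.1 then some (some (s.2.2, p.drop (s.1 + 1))) else none

theorem primrec_parse (M : PrefixTM) : Primrec₂ M.parse := by
  refine Primrec.option_bind M.primrec_snapshot ?_
  have hs : Primrec fun a : (List Bool × ℕ) × ℕ × Bool × List Bool => a.2.2.1 :=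
    Primrec.fst.comp (Primrec.snd.comp Primrec.snd)
  have hp : Primrec fun a : (List Bool × ℕ) × ℕ × Bool × List Bool => a.1.1 :=
    Primrec.fst.comp Primrec.fst
  have hpos : Primrec fun a : (List Bool × ℕ) × ℕ × Bool × List Bool => a.2.1 :=
    Primrec.fst.comp Primrec.snd
  refine Primrec.ite (Primrec.nat_le.comp (Primrec.list_length.comp hp) hpos)
    (Primrec.const _) ?_
  refine (Primrec.cond hs (Primrec.option_some.comp (Primrec.option_some.comp (Primrec.pair
    (Primrec.snd.comp (Primrec.snd.comp Primrec.snd))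
    (Primrec.list_drop.comp (Primrec.succ.comp hpos) hp))))
    (Primrec.const none)).of_eq fun ⟨_, _, b, _⟩ => ?_
  cases b <;> rfl

theorem mem_parse_append {q y r : List Bool} (h : M.Computes q y) :
    some (y, r) ∈ Nat.rfindOpt (M.parse (q ++ r)) := by
  obtain ⟨t, ht⟩ := h
  obtain ⟨C, hC, hs, hq, rfl⟩ := haltAt_eq_some.1 (haltAt_append (r := r) ht)
  refine mem_rfindOpt_of_unique (n := t) ?_ fun t' b hb => ?_
  · simp [parse, snapshot, hC, hs, hq, show ¬ (q.length + r.length ≤ C.inputPos) by omega]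
  · simp only [parse, snapshot, Option.bind_eq_some_iff, Option.map_eq_some_iff] at hb
    obtain ⟨_, ⟨C', hC', rfl⟩, hb⟩ := hb
    rcases lt_trichotomy t t' with hlt | rfl | hlt
    · exact absurd hs (run_step_ne_none hlt hC hC')
    · rw [hC, Option.some.injEq] at hC'
      subst hC'
      simpa [hs, hq, show ¬ (q.length + r.length ≤ C.inputPos) by omega, eq_comm] using hb
    · have h₁ := run_step_ne_none hlt hC' hC
      obtain ⟨C'', hC'', hle⟩ := run_mono hlt.le hC
      rw [hC', Option.some.injEq] at hC''
      subst hC''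
      simp [h₁, show ¬ (q.length + r.length ≤ C'.inputPos) by omega] at hb

theorem mem_parse_of_isPrefix {p q y : List Bool} (h : M.Computes q y) (hp : p <+: q) (hne : p ≠ q) :
    none ∈ Nat.rfindOpt (M.parse p) := by
  obtain ⟨t, C, hC, hs, hq, rfl⟩ := h
  obtain ⟨r, rfl⟩ := hp
  have hr : 0 < r.length := List.length_pos_of_ne_nil (by rintro rfl; simp at hne)
  simp only [List.length_append] at hq
  -- Consider the first time at which the head is beyond `p`. Up to then only `p` has been scanned,
  -- so the run on `p` alone agrees.
  have hex : ∃ t C, M.run (pad (p ++ r)) t = some C ∧ p.length ≤ C.inputPos :=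
    ⟨t, C, hC, by omega⟩
  classical
  obtain ⟨C₀, hC₀, hle₀⟩ := Nat.find_spec hex
  have hmin := fun t (ht : t < Nat.find hex) => Nat.find_min hex ht
  generalize Nat.find hex = t₀ at hC₀ hmin
  have hrun : M.run (pad p) t₀ = some C₀ := by
    cases t₀ with
    | zero => exact hC₀
    | succ s =>
      obtain ⟨D, hD, -⟩ := run_mono (Nat.le_succ s) hC₀
      have hlt : D.inputPos < p.length := by
        by_contra hlt
        exact hmin s (Nat.lt_succ_self s) ⟨D, hD, by omega⟩
      have hD' := run_congr (ω' := pad p) hD fun i hi => pad_append (by omega)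
      simp only [run, hD, Option.bind_some] at hC₀
      simp only [run, hD', Option.bind_some]
      rw [← hC₀]
      exact (step_congr (pad_append hlt)).symm
  refine mem_rfindOpt_of_unique (n := t₀) ?_ fun t' b hb => ?_
  · simp [parse, snapshot, hrun, hle₀]
  · simp only [parse, snapshot, Option.bind_eq_some_iff, Option.map_eq_some_iff] at hb
    obtain ⟨_, ⟨C', hC', rfl⟩, hb⟩ := hb
    by_cases hle : p.length ≤ C'.inputPos
    · simpa [hle, eq_comm] using hb
    · exfalso
      have hlt : t' < t₀ := by
        by_contra hge
        obtain ⟨D, hD, hDle⟩ := run_mono (not_lt.1 hge) hC'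
        rw [hrun, Option.some.injEq] at hD
        subst hD
        omega
      have h₁ := run_step_ne_none hlt hC' hrun
      simp [hle, h₁] at hb

/-- An optimal machine can run itself on the beginning of its input, and then decode the rest of its
input with the help of the result. -/
theorem IsOptimal.exists_index {U : PrefixTM} (hU : U.IsOptimal)
    {H : List Bool × List Bool →. Option (List Bool)} (hH : Partrec H) :
    ∃ i : List Bool, ∀ q y r z : List Bool, U.Computes q y → some z ∈ H (y, r) →
      (∀ r', r' <+: r → r' ≠ r → none ∈ H (y, r')) → U.Computes (i ++ (q ++ r)) z := by
  let G : List Bool →. Option (List Bool) := fun p =>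
    (Nat.rfindOpt (U.parse p)).bind fun s =>
      Option.casesOn (motive := fun _ => Part (Option (List Bool))) s (Part.some none) H
  have hG : Partrec G := by
    refine (Partrec.rfindOpt U.primrec_parse.to_comp).bind ?_
    exact Partrec.optionCasesOn_right (o := fun a : List Bool × Option (List Bool × List Bool) =>
      a.2) (f := fun _ => none) (g := fun _ b => H b) Computable.snd (Computable.const _)
      (hH.comp Computable.snd)
  obtain ⟨T, hT⟩ := exists_of_partrec hG
  obtain ⟨i, hi⟩ := hU T
  refine ⟨i, fun q y r z hq hz hr => (hi _ _).2 (hT _ _ ?_ ?_ fun p _ hp hne => ?_)⟩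
  · simp [hq.ne_nil]
  · exact Part.mem_bind (mem_parse_append hq) hz
  · rcases List.prefix_or_prefix_of_prefix hp (List.prefix_append q r) with hpq | ⟨r', rfl⟩
    · by_cases e : p = q
      · subst e
        have := mem_parse_append (r := []) hq
        rw [List.append_nil] at this
        refine Part.mem_bind this (hr [] List.nil_prefix ?_)
        rintro rfl; simp at hne
      · exact Part.mem_bind (mem_parse_of_isPrefix hq hpq e) (Part.mem_some _)
    · refine Part.mem_bind (mem_parse_append hq) (hr r' ?_ ?_)
      · exact (List.prefix_append_right_inj q).1 hp
      · rintro rfl; exact hne rfl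

end PrefixTM

/-! ### Binary strings, numbers and a self-delimiting code -/

namespace BinaryString

/-- All binary strings of length `k`. -/
def strs : ℕ → List (List Bool)
  | 0 => [[]]
  | k + 1 => (strs k).map (false :: ·) ++ (strs k).map (true :: ·)

theorem mem_strs {k : ℕ} {s : List Bool} : s ∈ strs k ↔ s.length = k := by
  induction k generalizing s with
  | zero => simp [strs]
  | succ k ih => rcases s with _ | ⟨_ | _, s⟩ <;> simp [strs, ih]

theorem length_strs (k : ℕ) : (strs k).length = 2 ^ k := by
  induction k with
  | zero => rfl
  | succ k ih => simp [strs, ih, pow_succ, mul_two]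

theorem nodup_strs (k : ℕ) : (strs k).Nodup := by
  induction k with
  | zero => simp [strs]
  | succ k ih =>
    refine List.Nodup.append (ih.map fun _ _ h => (List.cons.inj h).2)
      (ih.map fun _ _ h => (List.cons.inj h).2) ?_
    simp [List.disjoint_left]

/-- The enumeration is lexicographic, so the extensions of a given string are consecutive. This
gives each fast program a contiguous block later on. -/
theorem strs_add (a k : ℕ) : strs (a + k) = (strs a).flatMap fun p => (strs k).map (p ++ ·) := by
  induction a with
  | zero => simp [strs]
  | succ a ih =>
    rw [Nat.add_right_comm, strs, ih, strs]
    simp [List.flatMap_map, List.map_flatMap, Function.comp_def]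

theorem primrec_strs : Primrec strs := by
  refine (Primrec.nat_rec₁ (f := fun _ l => l.map (false :: ·) ++ l.map (true :: ·))
    [[]] ?_).of_eq fun k => ?_
  · exact Primrec.list_append.comp
      (Primrec.list_map Primrec.snd (Primrec.list_cons.comp (Primrec.const _) Primrec.snd))
      (Primrec.list_map Primrec.snd (Primrec.list_cons.comp (Primrec.const _) Primrec.snd))
  · induction k with
    | zero => rfl
    | succ k ih => rw [strs, ← ih]

/-- The number whose binary digits are the given ones. -/
def val (r : List Bool) : ℕ := r.foldl (fun n b => 2 * n + b.toNat) 0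

theorem primrec_val : Primrec val := by
  refine Primrec.list_foldl (h := fun _ (a : ℕ × Bool) => 2 * a.1 + a.2.toNat)
    Primrec.id (Primrec.const 0) ?_
  exact Primrec.nat_add.comp (Primrec.nat_double.comp (Primrec.fst.comp Primrec.snd))
    ((Primrec.dom_finite Bool.toNat).comp (Primrec.snd.comp Primrec.snd))

theorem val_concat (r : List Bool) (b : Bool) : val (r ++ [b]) = 2 * val r + b.toNat := by
  simp [val]

theorem val_append (r u : List Bool) :
    val (r ++ u) = val r * 2 ^ u.length + val u := by
  induction u using List.reverseRecOn with
  | nil => simp [val]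
  | append_singleton u b ih =>
    rw [← List.append_assoc, val_concat, ih, val_concat, List.length_append, List.length_singleton,
      pow_succ]
    ring

theorem val_lt (r : List Bool) : val r < 2 ^ r.length := by
  induction r using List.reverseRecOn with
  | nil => simp [val]
  | append_singleton r b ih =>
    rw [val_concat, List.length_append, List.length_singleton, pow_succ]
    have := b.toNat_le
    omega

theorem exists_val {k v : ℕ} (h : v < 2 ^ k) : ∃ r : List Bool, r.length = k ∧ val r = v := by
  induction k generalizing v with
  | zero => exact ⟨[], rfl, by simp at h; simp [h, val]⟩
  | succ k ih =>
    obtain ⟨r, hr, hv⟩ := ih (v := v / 2) (by rw [pow_succ] at h; omega)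
    refine ⟨r ++ [decide (v % 2 = 1)], by simp [hr], ?_⟩
    rw [val_concat, hv]
    rcases Nat.mod_two_eq_zero_or_one v with h | h <;> simp [h] <;> omega

/-- The binary digits of `v`, with leading zeros so that there are `k` of them. -/
def word (k v : ℕ) : List Bool := ((strs k).filter (val · = v)).headI

theorem word_spec {k v : ℕ} (h : v < 2 ^ k) : (word k v).length = k ∧ val (word k v) = v := by
  obtain ⟨r, hr, hv⟩ := exists_val h
  have hm : r ∈ (strs k).filter (val · = v) := by simp [mem_strs, hr, hv]
  have : word k v ∈ (strs k).filter (val · = v) := by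
    unfold word
    cases hl : (strs k).filter (val · = v) with
    | nil => simp [hl] at hm
    | cons a l => simp
  simpa [mem_strs] using this

theorem primrec_word : Primrec₂ word := by
  have h : PrimrecRel fun (r : List Bool) (v : ℕ) => val r = v :=
    Primrec.eq.comp (primrec_val.comp Primrec.fst) Primrec.snd
  refine Primrec.list_headI.comp ?_
  exact (PrimrecRel.listFilter h).comp (primrec_strs.comp Primrec.fst) Primrec.snd

theorem primrec_replicate_true : Primrec fun n => List.replicate n true := by
  refine (Primrec.nat_rec₁ (f := fun _ l => true :: l) [] ?_).of_eq fun k => ?_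
  · exact Primrec.list_cons.comp (Primrec.const _) Primrec.snd
  · induction k with
    | zero => rfl
    | succ k ih => rw [List.replicate_succ, ← ih]

theorem primrec_two_pow : Primrec fun n => 2 ^ n := by
  refine (Primrec.list_length.comp primrec_strs).of_eq length_strs

theorem primrec_log : Primrec (Nat.log 2) := by
  have h : PrimrecRel fun (n k : ℕ) => 2 ^ k ≤ n :=
    Primrec.nat_le.comp (primrec_two_pow.comp Primrec.snd) Primrec.fst
  refine (Primrec.nat_findGreatest Primrec.id h).of_eq fun n => ?_
  rcases Nat.eq_zero_or_pos n with rfl | hn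
  · simp
  rw [id, Nat.findGreatest_eq_iff]
  refine ⟨Nat.log_le_self _ _, fun _ => Nat.pow_log_le_self 2 hn.ne', fun k hk _ => ?_⟩
  exact not_le.2 (Nat.lt_pow_of_log_lt one_lt_two hk)

/-- A self-delimiting code of `x`: the number of binary digits of the length in unary, the binary
digits of the length, and `x` itself. -/
def litCode (x : List Bool) : List Bool :=
  List.replicate (Nat.log 2 x.length + 1) true ++
    false :: (word (Nat.log 2 x.length + 1) x.length ++ x)

theorem length_word_log (n : ℕ) :
    (word (Nat.log 2 n + 1) n).length = Nat.log 2 n + 1 ∧ val (word (Nat.log 2 n + 1) n) = n :=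
  word_spec (Nat.lt_pow_succ_log_self one_lt_two n)

theorem length_litCode (x : List Bool) :
    (litCode x).length = x.length + 2 * Nat.log 2 x.length + 3 := by
  simp [litCode, length_word_log]; ring

theorem primrec_litCode : Primrec litCode := by
  have hk : Primrec fun x : List Bool => Nat.log 2 x.length + 1 :=
    Primrec.succ.comp (primrec_log.comp Primrec.list_length)
  exact Primrec.list_append.comp (primrec_replicate_true.comp hk)
    (Primrec.list_cons.comp (Primrec.const false)
      (Primrec.list_append.comp (primrec_word.comp hk Primrec.list_length) Primrec.id))

/-- Decoder for `litCode`; `none` asks for more digits. -/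
def litDecode (r : List Bool) : Option (List Bool) :=
  let k := (r.takeWhile id).length
  if r.length < 2 * k + 1 + val ((r.drop (k + 1)).take k) then none
  else some (r.drop (2 * k + 1))

theorem primrec_litDecode : Primrec litDecode := by
  have hk : Primrec fun r : List Bool => (r.takeWhile id).length :=
    Primrec.list_length.comp (Primrec.list_takeWhile Primrec.id)
  have hk' : Primrec fun r : List Bool => 2 * (r.takeWhile id).length + 1 :=
    Primrec.nat_double_succ.comp hk
  refine Primrec.ite (Primrec.nat_lt.comp Primrec.list_length (Primrec.nat_add.comp hk'
    (primrec_val.comp (Primrec.list_take.comp hk (Primrec.list_drop.comp (Primrec.succ.comp hk)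
    Primrec.id))))) (Primrec.const none) ?_
  exact Primrec.option_some.comp (Primrec.list_drop.comp hk' Primrec.id)

theorem takeWhile_unary (k : ℕ) (s : List Bool) :
    (List.replicate k true ++ false :: s).takeWhile id = List.replicate k true := by
  induction k with
  | zero => simp
  | succ k ih => simp [List.replicate_succ, ih]

theorem litDecode_unary (k : ℕ) (s : List Bool) :
    litDecode (List.replicate k true ++ false :: s) =
      if s.length < k + val (s.take k) then none else some (s.drop k) := by
  simp only [litDecode, takeWhile_unary, List.length_replicate]
  have e : ∀ j, (List.replicate k true ++ false :: s).drop (k + (j + 1)) = s.drop j := by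
    intro j
    rw [List.drop_append]
    simp
  rw [e 0, show 2 * k + 1 = k + (k + 1) by ring, e k]
  simp only [List.drop_zero, List.length_append, List.length_replicate, List.length_cons]
  congr 1
  exact propext ⟨fun h => by omega, fun h => by omega⟩

theorem litDecode_litCode (x : List Bool) : litDecode (litCode x) = some x := by
  obtain ⟨h₁, h₂⟩ := length_word_log x.length
  rw [litCode, litDecode_unary]
  generalize word (Nat.log 2 x.length + 1) x.length = s at h₁ h₂
  rw [← h₁]
  simp [h₂]

/-- A prefix inside the unary block or inside the length field is shorter than `2 * k + 1`; behind
these fields the announced length is known and not yet reached. -/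
theorem litDecode_of_isPrefix {x r : List Bool} (h : r <+: litCode x) (hne : r ≠ litCode x) :
    litDecode r = none := by
  obtain ⟨h₁, h₂⟩ := length_word_log x.length
  obtain ⟨u, hu⟩ := h
  rw [litCode] at hu
  rcases List.append_eq_append_iff.1 hu with ⟨a, ha, -⟩ | ⟨a, rfl, ha⟩
  · have hr : r = List.replicate r.length true := by
      refine List.eq_replicate_iff.2 ⟨rfl, fun b hb => ?_⟩
      have : b ∈ List.replicate (Nat.log 2 x.length + 1) true := by
        rw [ha]; exact List.mem_append_left _ hb
      exact List.eq_of_mem_replicate this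
    rw [hr, litDecode]
    simp
    omega
  · cases a with
    | nil =>
      simp [litDecode]
      omega
    | cons b a =>
      simp only [List.cons_append, List.cons.injEq] at ha
      obtain ⟨rfl, ha⟩ := ha
      rw [litDecode_unary, if_pos]
      generalize hs : word (Nat.log 2 x.length + 1) x.length = s at h₁ h₂ ha
      have hlen := congrArg List.length ha
      simp only [List.length_append] at hlen
      have hu : 0 < u.length := by
        refine List.length_pos_of_ne_nil ?_
        rintro rfl
        apply hne
        rw [litCode, hs, ha, List.append_nil]
      by_cases hk : a.length < s.length
      · omega
      · have : a.take (Nat.log 2 x.length + 1) = s := by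
          have := congrArg (List.take s.length) ha
          rw [List.take_left, List.take_append_of_le_length (by omega)] at this
          rw [← h₁, ← this]
        rw [this, h₂]
        omega

end BinaryString

/-! ### Complexity bounds and literal programs -/

namespace PrefixTM

open BinaryString

variable {U : PrefixTM}

theorem K_le {p x : List Bool} (h : U.Computes p x) : U.K x ≤ p.length :=
  Nat.sInf_le ⟨p, h, rfl⟩

theorem exists_shortest {p x : List Bool} (h : U.Computes p x) :
    ∃ q, U.Computes q x ∧ q.length = U.K x :=
  Nat.sInf_mem (s := {n | ∃ p : List Bool, U.Computes p x ∧ p.length = n}) ⟨_, p, h, rfl⟩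

/-- `IsOptimal.exists_index` needs a first program to run; decoders that ignore its output use this
one. -/
theorem IsOptimal.exists_computes (hU : U.IsOptimal) : ∃ p y : List Bool, U.Computes p y := by
  obtain ⟨T, hT⟩ := exists_of_partrec (G := fun _ => Part.some (some []))
    (Computable.const (some [])).partrec
  obtain ⟨i, hi⟩ := hU T
  refine ⟨i ++ [true], [], (hi _ _).2 (hT _ _ (by simp) (Part.mem_some _) fun q hq hp hne => ?_)⟩
  obtain ⟨u, hu⟩ := hp
  rcases List.append_eq_singleton_iff.1 hu with ⟨rfl, -⟩ | ⟨rfl, -⟩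
  · exact absurd rfl hq
  · exact absurd rfl hne

theorem IsOptimal.exists_literal (hU : U.IsOptimal) :
    ∃ (lit : List Bool → List Bool) (C : ℕ), Primrec lit ∧ (∀ x, U.Computes (lit x) x) ∧
      ∀ x, 2 ≤ x.length → (lit x).length ≤ x.length + C * Nat.log 2 x.length := by
  obtain ⟨q, y, hq⟩ := hU.exists_computes
  obtain ⟨i, hi⟩ := hU.exists_index (H := fun a => Part.some (litDecode a.2))
    (primrec_litDecode.comp Primrec.snd).to_comp.partrec
  -- As the logarithm is at least 1, the additive 3 of `litCode` and the fixed prefix are absorbed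
  -- into its coefficient.
  refine ⟨fun x => i ++ (q ++ litCode x), i.length + q.length + 5, ?_, fun x => ?_, fun x hx => ?_⟩
  · exact Primrec.list_append.comp (Primrec.const i)
      (Primrec.list_append.comp (Primrec.const q) primrec_litCode)
  · refine hi q y _ _ hq ?_ fun r hr hne => ?_
    · simp [litDecode_litCode]
    · simp [litDecode_of_isPrefix hr hne]
  · have : 1 ≤ Nat.log 2 x.length := Nat.log_pos one_lt_two hx
    simp only [List.length_append, length_litCode]
    nlinarith

theorem IsOptimal.K_map_le (hU : U.IsOptimal) {F : List Bool →. List Bool} (hF : Partrec F) :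
    ∃ C, ∀ y z, z ∈ F y → U.K z ≤ U.K y + C := by
  obtain ⟨lit, -, -, hlit, -⟩ := hU.exists_literal
  obtain ⟨i, hi⟩ := hU.exists_index (H := fun a => (F a.1).map some)
    ((hF.comp Computable.fst).map (Computable.option_some.comp Computable.snd))
  refine ⟨i.length, fun y z hz => ?_⟩
  obtain ⟨q, hq, hlen⟩ := exists_shortest (hlit y)
  have := K_le (hi q y [] z hq (Part.mem_map _ hz) fun r hr hne =>
    absurd (List.prefix_nil.1 hr) hne)
  simp only [List.length_append, List.length_nil] at this
  omega

/-- The partial function that a prefix machine computes. -/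
noncomputable def evalPart (M : PrefixTM) (p : List Bool) : Part (List Bool) :=
  Nat.rfindOpt fun t => (M.haltAt p t).bind fun a => if a.1 = p.length then some a.2 else none

theorem partrec_evalPart (M : PrefixTM) : Partrec M.evalPart := by
  refine Partrec.rfindOpt (Primrec.to_comp ?_)
  refine Primrec.option_bind M.primrec_haltAt ?_
  exact Primrec.ite (Primrec.eq.comp (Primrec.fst.comp Primrec.snd)
    (Primrec.list_length.comp (Primrec.fst.comp Primrec.fst)))
    (Primrec.option_some.comp (Primrec.snd.comp Primrec.snd)) (Primrec.const none)

theorem mem_evalPart {p y : List Bool} (h : U.Computes p y) : y ∈ U.evalPart p := by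
  obtain ⟨t, ht⟩ := h
  have h₁ := haltAt_iff_halts.2 ht
  refine mem_rfindOpt_of_unique (n := t) (by simp [h₁]) fun t' b hb => ?_
  simp only [Option.bind_eq_some_iff] at hb
  obtain ⟨a, ha, hb⟩ := hb
  obtain ⟨rfl, rfl⟩ := haltAt_unique h₁ ha
  simpa [eq_comm] using hb

/-- Serves twice: it makes shortest programs incompressible up to a constant, and it bounds the
complexity of literal programs from below. -/
theorem IsOptimal.K_output_le (hU : U.IsOptimal) :
    ∃ C, ∀ p x, U.Computes p x → U.K x ≤ U.K p + C := by
  obtain ⟨C, hC⟩ := hU.K_map_le U.partrec_evalPart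
  exact ⟨C, fun p x h => hC p x (mem_evalPart h)⟩

theorem IsOptimal.exists_shortestIncompressible (hU : U.IsOptimal) :
    ∃ c, U.ShortestIncompressible c := by
  obtain ⟨lit, -, -, hlit, -⟩ := hU.exists_literal
  obtain ⟨C, hC⟩ := hU.K_output_le
  refine ⟨C, fun x => ?_⟩
  obtain ⟨p, hp, hlen⟩ := exists_shortest (hlit x)
  exact ⟨p, hp, hlen, hlen ▸ hC p x hp⟩

/-- The result of running the machine for at most `T` steps. -/
noncomputable def within (M : PrefixTM) (s : List Bool) (T : ℕ) : Option (ℕ × List Bool) :=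
  ((List.range (T + 1)).filterMap (M.haltAt s)).head?

theorem primrec_within (M : PrefixTM) : Primrec₂ M.within :=
  Primrec.list_head?.comp (Primrec.listFilterMap
    (Primrec.list_range.comp (Primrec.succ.comp Primrec.snd))
    (M.primrec_haltAt.comp (Primrec.fst.comp Primrec.fst) Primrec.snd))

theorem within_eq_some {M : PrefixTM} {s : List Bool} {T : ℕ} {a : ℕ × List Bool} :
    M.within s T = some a ↔ ∃ t ≤ T, M.haltAt s t = some a := by
  constructor
  · intro h
    have := List.mem_of_mem_head? (Option.mem_def.2 h)
    simp only [List.mem_filterMap, List.mem_range] at this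
    obtain ⟨t, ht, h⟩ := this
    exact ⟨t, by omega, h⟩
  · rintro ⟨t, ht, h⟩
    have hm : a ∈ (List.range (T + 1)).filterMap (M.haltAt s) := by
      simp only [List.mem_filterMap, List.mem_range]
      exact ⟨t, by omega, h⟩
    unfold within
    cases hl : (List.range (T + 1)).filterMap (M.haltAt s) with
    | nil => simp [hl] at hm
    | cons b l =>
      have hb : b ∈ (List.range (T + 1)).filterMap (M.haltAt s) := by simp [hl]
      simp only [List.mem_filterMap, List.mem_range] at hb
      obtain ⟨t', -, h'⟩ := hb
      simp [(haltAt_unique h h').2]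

/-- There are finitely many strings of each length, so one can search for a time within which all
their codes have halted. -/
theorem exists_computable_time {code : List Bool → List Bool} (hc : Primrec code)
    (h : ∀ x, U.Computes (code x) x) :
    ∃ g : ℕ → ℕ, Computable g ∧ ∀ x, ∃ t ≤ g x.length, U.Halts (code x) x t := by
  choose τ hτ using h
  let good : ℕ → ℕ → Bool := fun n T =>
    (strs n).foldr (fun x b => (U.within (code x) T).isSome && b) true
  have hgood : ∀ {n T}, good n T = true ↔ ∀ x : List Bool, x.length = n → τ x ≤ T := by
    intro n T
    have : ∀ l : List (List Bool),
        l.foldr (fun x b => (U.within (code x) T).isSome && b) true = true ↔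
          ∀ x ∈ l, (U.within (code x) T).isSome := by
      intro l
      induction l <;> simp_all
    simp only [good, this, mem_strs]
    refine forall₂_congr fun x _ => ?_
    rw [Option.isSome_iff_exists]
    simp only [within_eq_some]
    constructor
    · rintro ⟨a, t, ht, ha⟩
      exact (haltAt_unique (haltAt_iff_halts.2 (hτ x)) ha).1 ▸ ht
    · exact fun hx => ⟨_, τ x, hx, haltAt_iff_halts.2 (hτ x)⟩
  have hprim : Primrec₂ good := by
    refine Primrec.list_foldr (h := fun (a : ℕ × ℕ) (x : List Bool × Bool) =>
      (U.within (code x.1) a.2).isSome && x.2) (primrec_strs.comp Primrec.fst)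
      (Primrec.const true) ?_
    exact Primrec.and.comp (Primrec.option_isSome.comp (U.primrec_within.comp
      (hc.comp (Primrec.fst.comp Primrec.snd)) (Primrec.snd.comp Primrec.fst)))
      (Primrec.snd.comp Primrec.snd)
  let f : ℕ → ℕ → Option ℕ := fun n T => if good n T then some T else none
  have hf : Partrec fun n => Nat.rfindOpt (f n) := by
    refine Partrec.rfindOpt (Primrec.to_comp ?_)
    refine (Primrec.cond hprim (Primrec.option_some.comp Primrec.snd)
      (Primrec.const none)).of_eq fun a => ?_
    cases h : good a.1 a.2 <;> simp [f, h]
  have hdom : ∀ n, (Nat.rfindOpt (f n)).Dom := by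
    intro n
    refine Nat.rfindOpt_dom.2 ?_
    have : good n ((strs n).map τ).sum = true :=
      hgood.2 fun x hx => List.le_sum_of_mem (List.mem_map_of_mem (mem_strs.2 hx))
    exact ⟨_, _, if_pos this⟩
  refine ⟨fun n => (Nat.rfindOpt (f n)).get (hdom n),
    Partrec.of_eq_tot hf fun n => Part.get_mem _, fun x => ⟨τ x, ?_, hτ x⟩⟩
  obtain ⟨T, hT⟩ := Nat.rfindOpt_spec (Part.get_mem (hdom x.length))
  change τ x ≤ (Nat.rfindOpt (f x.length)).get (hdom x.length)
  generalize (Nat.rfindOpt (f x.length)).get (hdom x.length) = g at hT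
  simp only [f, Option.mem_def] at hT
  split_ifs at hT with hg
  cases hT
  exact hgood.1 hg x rfl

end PrefixTM

open BinaryString

/-! ### Slow strings, and compression of their fast programs -/

namespace PrefixTM

/-- For every input string of length `T + 2` on which the machine outputs `x` within `T` steps, the
segment that it scans. -/
noncomputable def fastPrograms (M : PrefixTM) (x : List Bool) (T : ℕ) : List (List Bool) :=
  (strs (T + 2)).filterMap fun s =>
    (M.within s T).bind fun a => if a.2 = x then some (s.take a.1) else none

theorem primrec_fastPrograms (M : PrefixTM) : Primrec₂ M.fastPrograms := by
  refine Primrec.listFilterMap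
    (primrec_strs.comp (Primrec.succ.comp (Primrec.succ.comp Primrec.snd))) ?_
  refine Primrec.option_bind (M.primrec_within.comp Primrec.snd
    (Primrec.snd.comp Primrec.fst)) ?_
  exact Primrec.ite (Primrec.eq.comp (Primrec.snd.comp Primrec.snd)
    (Primrec.fst.comp (Primrec.fst.comp Primrec.fst)))
    (Primrec.option_some.comp (Primrec.list_take.comp (Primrec.fst.comp Primrec.snd)
      (Primrec.snd.comp Primrec.fst))) (Primrec.const none)

/-- The first string of length `n` with few fast programs. -/
noncomputable def slowString (M : PrefixTM) (n T : ℕ) : List Bool :=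
  ((strs n).filter fun x => (M.fastPrograms x T).length * 2 ^ n ≤ 2 ^ (T + 2)).headI

theorem primrec_slowString (M : PrefixTM) : Primrec₂ M.slowString := by
  have h : PrimrecRel fun (x : List Bool) (a : ℕ × ℕ) =>
      (M.fastPrograms x a.2).length * 2 ^ a.1 ≤ 2 ^ (a.2 + 2) := by
    refine Primrec.nat_le.comp (Primrec.nat_mul.comp (Primrec.list_length.comp
      (M.primrec_fastPrograms.comp Primrec.fst (Primrec.snd.comp Primrec.snd)))
      (primrec_two_pow.comp (Primrec.fst.comp Primrec.snd))) ?_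
    exact primrec_two_pow.comp (Primrec.succ.comp (Primrec.succ.comp
      (Primrec.snd.comp Primrec.snd)))
  exact Primrec.list_headI.comp ((PrimrecRel.listFilter h).comp
    (primrec_strs.comp Primrec.fst) (Primrec.pair Primrec.fst Primrec.snd))

theorem length_fastPrograms (M : PrefixTM) (x : List Bool) (T : ℕ) :
    (M.fastPrograms x T).length =
      ((strs (T + 2)).filter fun s => (M.within s T).map Prod.snd = some x).length := by
  unfold fastPrograms
  induction strs (T + 2) with
  | nil => rfl
  | cons s l ih =>
    rw [List.filterMap_cons, List.filter_cons]
    rcases M.within s T with _ | ⟨k, y⟩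
    · simpa using ih
    · by_cases hy : y = x <;> simp [hy, ih]

/-- Each input string yields at most one output, so it is counted for at most one `x`. -/
theorem sum_length_fastPrograms_le (M : PrefixTM) (n T : ℕ) :
    ∑ x ∈ (strs n).toFinset, (M.fastPrograms x T).length ≤ 2 ^ (T + 2) := by
  have h : ∀ x, (M.fastPrograms x T).length =
      ((strs (T + 2)).toFinset.filter fun s => (M.within s T).map Prod.snd = some x).card := by
    intro x
    rw [length_fastPrograms, ← List.toFinset_card_of_nodup ((nodup_strs _).filter _),
      List.toFinset_filter]
    congr 1
    ext s
    simp
  simp only [h]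
  rw [← Finset.card_biUnion]
  · refine (Finset.card_le_card (Finset.biUnion_subset.2 fun x _ => Finset.filter_subset _ _)).trans
      ?_
    rw [List.toFinset_card_of_nodup (nodup_strs _), length_strs]
  · intro x _ y _ hxy
    refine Finset.disjoint_filter.2 fun s _ h₁ h₂ => hxy ?_
    rw [h₁] at h₂
    exact Option.some.inj h₂

theorem slowString_spec (M : PrefixTM) (n T : ℕ) :
    (M.slowString n T).length = n ∧
      (M.fastPrograms (M.slowString n T) T).length * 2 ^ n ≤ 2 ^ (T + 2) := by
  have hex : ∃ x ∈ (strs n).toFinset, (M.fastPrograms x T).length * 2 ^ n ≤ 2 ^ (T + 2) := by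
    by_contra! h
    have hne : (strs n).toFinset.Nonempty :=
      ⟨List.replicate n true, by simp [mem_strs]⟩
    have h₁ := Finset.sum_lt_sum_of_nonempty hne h
    rw [Finset.sum_const, List.toFinset_card_of_nodup (nodup_strs _), length_strs,
      ← Finset.sum_mul, smul_eq_mul, mul_comm] at h₁
    exact absurd (Nat.lt_of_mul_lt_mul_right h₁) (not_lt.2 (M.sum_length_fastPrograms_le n T))
  obtain ⟨x, hx, hle⟩ := hex
  have hm : x ∈ (strs n).filter fun x => (M.fastPrograms x T).length * 2 ^ n ≤ 2 ^ (T + 2) := by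
    simp only [List.mem_filter, decide_eq_true_eq]
    exact ⟨List.mem_toFinset.1 hx, hle⟩
  have : M.slowString n T ∈
      (strs n).filter fun x => (M.fastPrograms x T).length * 2 ^ n ≤ 2 ^ (T + 2) := by
    unfold slowString
    cases hl : (strs n).filter fun x => (M.fastPrograms x T).length * 2 ^ n ≤ 2 ^ (T + 2) with
    | nil => simp [hl] at hm
    | cons a l => simp
  simpa [mem_strs] using this

/-- The multiplicity of `p` is the number of its extensions, which makes list length a measure of `2
^ (-|p|)`. -/
theorem exists_fastPrograms_eq {M : PrefixTM} {p x : List Bool} {t T : ℕ} (ht : t ≤ T)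
    (h : M.Halts p x t) (hlen : p.length ≤ T + 2) :
    ∃ l r, M.fastPrograms x T = l ++ List.replicate (2 ^ (T + 2 - p.length)) p ++ r := by
  obtain ⟨k, hk⟩ := Nat.exists_eq_add_of_le hlen
  obtain ⟨l, r, hlr⟩ := List.append_of_mem (mem_strs.2 (rfl : p.length = p.length))
  unfold fastPrograms
  rw [hk, strs_add, hlr, Nat.add_sub_cancel_left]
  simp only [List.flatMap_append, List.flatMap_cons, List.filterMap_append, List.filterMap_map]
  rw [← List.append_assoc]
  refine ⟨_, _, congrArg₂ _ (congrArg₂ _ rfl ?_) rfl⟩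
  rw [← length_strs]
  induction strs k with
  | nil => rfl
  | cons s l ih =>
    have : M.within (p ++ s) T = some (p.length, x) :=
      within_eq_some.2 ⟨t, ht, haltAt_append h⟩
    simp only [Function.comp_def] at ih
    simp [this, ih, List.replicate_succ]

theorem Halts.length_le {M : PrefixTM} {p y : List Bool} {t : ℕ} (h : M.Halts p y t) :
    p.length ≤ t + 1 := by
  obtain ⟨C, hC, -, hp, -⟩ := h
  suffices ∀ t C, M.run (pad p) t = some C → C.inputPos ≤ t by
    have := this t C hC
    omega
  clear hC hp
  intro t
  induction t with
  | zero => rintro C hC; cases hC; exact le_rfl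
  | succ t ih =>
    intro C hC
    simp only [run, Option.bind_eq_some_iff] at hC
    obtain ⟨D, hD, hs⟩ := hC
    simp only [step, Option.map_eq_some_iff] at hs
    obtain ⟨a, -, rfl⟩ := hs
    have := ih D hD
    dsimp only
    split_ifs
    · exact Nat.succ_le_succ this
    · exact this.trans (Nat.le_succ t)

/-- The dyadic interval given by the digits `r`, as a segment of a list of length at most
`2 ^ depth`. -/
def dyadicSegment {α : Type*} (B : List α) (depth : ℕ) (r : List Bool) : List α :=
  (B.drop (val r * 2 ^ (depth - r.length))).take (2 ^ (depth - r.length))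

/-- The only entry of the list on a dyadic interval; `none` if there are several. -/
def dyadicEntry {α : Type*} [DecidableEq α] (B : List α) (depth : ℕ) (r : List Bool) : Option α :=
  (dyadicSegment B depth r).head?.bind fun p =>
    if dyadicSegment B depth r = List.replicate (2 ^ (depth - r.length)) p then some p else none

theorem dyadicEntry_eq_some {α : Type*} [DecidableEq α] {B : List α} {depth : ℕ} {r : List Bool}
    {p : α} : dyadicEntry B depth r = some p ↔
      dyadicSegment B depth r = List.replicate (2 ^ (depth - r.length)) p := by
  simp only [dyadicEntry, Option.bind_eq_some_iff]
  constructor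
  · rintro ⟨q, -, h⟩
    split_ifs at h with hq
    cases h
    exact hq
  · intro h
    refine ⟨p, ?_, by rw [if_pos h]⟩
    rw [h, List.head?_replicate, if_neg (by positivity)]

theorem getElem?_of_dyadicEntry {α : Type*} [DecidableEq α] {B : List α} {depth : ℕ}
    {r : List Bool} {p : α} (h : dyadicEntry B depth r = some p) {j : ℕ}
    (hj : j < 2 ^ (depth - r.length)) :
    B[val r * 2 ^ (depth - r.length) + j]? = some p := by
  have := congrArg (·[j]?) (dyadicEntry_eq_some.1 h)
  simpa [dyadicSegment, List.getElem?_take, hj, List.getElem?_drop] using this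

/-- The interval of `r` lies inside that of its prefix `r'`, so the two constant values agree. -/
theorem dyadicEntry_of_isPrefix {α : Type*} [DecidableEq α] {B : List α} {depth : ℕ} {r r' : List Bool}
    {p p' : α} (h : dyadicEntry B depth r = some p) (h' : dyadicEntry B depth r' = some p')
    (hr : r' <+: r) (hd : r.length ≤ depth) : p' = p := by
  obtain ⟨u, rfl⟩ := hr
  have h₁ := getElem?_of_dyadicEntry h (j := 0) (by positivity)
  rw [List.length_append] at hd
  have e : depth - r'.length = u.length + (depth - (r' ++ u).length) := by
    rw [List.length_append]; omega
  have h₂ := getElem?_of_dyadicEntry h' (j := val u * 2 ^ (depth - (r' ++ u).length)) (by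
    rw [e, pow_add]
    exact Nat.mul_lt_mul_of_pos_right (val_lt u) (by positivity))
  rw [e, pow_add, ← mul_assoc, ← add_mul, ← val_append] at h₂
  rw [add_zero, h₂] at h₁
  exact Option.some.inj h₁

/-- A block of length `2 ^ (k + 1)` contains an aligned interval of length `2 ^ k`: start at the
first multiple of `2 ^ k` in it. -/
theorem exists_dyadicEntry {α : Type*} [DecidableEq α] {l r : List α} {p : α} {depth k : ℕ}
    (hlen : (l ++ List.replicate (2 ^ (k + 1)) p ++ r).length ≤ 2 ^ depth) :
    k + 1 ≤ depth ∧ ∃ w : List Bool, w.length = depth - k ∧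
      dyadicEntry (l ++ List.replicate (2 ^ (k + 1)) p ++ r) depth w = some p := by
  have hk : k + 1 ≤ depth := by
    simp only [List.length_append, List.length_replicate] at hlen
    exact (Nat.pow_le_pow_iff_right one_lt_two).1 (by omega)
  refine ⟨hk, ?_⟩
  obtain ⟨d, rfl⟩ := Nat.exists_eq_add_of_le (Nat.le_of_succ_le hk)
  set v := (l.length + 2 ^ k - 1) / 2 ^ k with hv
  have hpos : 0 < 2 ^ k := by positivity
  have h₁ : l.length ≤ v * 2 ^ k := by
    have := Nat.div_add_mod (l.length + 2 ^ k - 1) (2 ^ k)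
    have := Nat.mod_lt (l.length + 2 ^ k - 1) hpos
    rw [← hv] at *
    rw [mul_comm v]
    omega
  have h₂ : v * 2 ^ k < l.length + 2 ^ k := by
    have := Nat.div_mul_le_self (l.length + 2 ^ k - 1) (2 ^ k)
    rw [← hv] at this
    omega
  simp only [List.length_append, List.length_replicate] at hlen
  have hvd : v < 2 ^ d := by
    have : v * 2 ^ k < 2 ^ d * 2 ^ k := by
      rw [← pow_add, add_comm d]
      rw [pow_succ] at hlen
      omega
    exact Nat.lt_of_mul_lt_mul_right this
  obtain ⟨w, hw, hval⟩ := exists_val hvd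
  refine ⟨w, by omega, dyadicEntry_eq_some.2 ?_⟩
  have e : k + d - w.length = k := by omega
  obtain ⟨j, hj⟩ := Nat.exists_eq_add_of_le h₁
  rw [dyadicSegment, e, hval, hj, List.append_assoc, List.drop_append, List.drop_eq_nil_of_le
    (by omega), List.nil_append, Nat.add_sub_cancel_left, List.drop_append,
    List.drop_replicate, List.take_append_of_le_length, List.take_replicate, min_eq_left]
  · rw [pow_succ]; omega
  · rw [List.length_replicate, pow_succ]; omega

theorem primrec_replicate {α : Type*} [Primcodable α] :
    Primrec₂ (fun n (a : α) => List.replicate n a) := by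
  refine (Primrec.list_map (f := fun a : ℕ × α => List.range a.1) (g := fun a _ => a.2)
    (Primrec.list_range.comp Primrec.fst) (Primrec.snd.comp Primrec.fst)).of_eq fun a => ?_
  simp

/-- Decoder for fast programs of slow strings. -/
noncomputable def fastDecode (M : PrefixTM) (a : List Bool × List Bool) : Option (List Bool) :=
  dyadicEntry
    (M.fastPrograms (M.slowString a.1.length.unpair.1 a.1.length.unpair.2) a.1.length.unpair.2)
    (a.1.length.unpair.2 + 2 - a.1.length.unpair.1) a.2

theorem primrec_fastDecode (M : PrefixTM) : Primrec M.fastDecode := by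
  have hN : Primrec fun a : List Bool × List Bool => a.1.length.unpair :=
    Primrec.unpair.comp (Primrec.list_length.comp Primrec.fst)
  have hn := Primrec.fst.comp hN
  have hT := Primrec.snd.comp hN
  have hB := M.primrec_fastPrograms.comp (M.primrec_slowString.comp hn hT) hT
  have hw := primrec_two_pow.comp (Primrec.nat_sub.comp (Primrec.nat_sub.comp
    (Primrec.succ.comp (Primrec.succ.comp hT)) hn)
    (Primrec.list_length.comp (Primrec.snd (α := List Bool) (β := List Bool))))
  have hseg := Primrec.list_take.comp hw (Primrec.list_drop.comp
    (Primrec.nat_mul.comp (primrec_val.comp Primrec.snd) hw) hB)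
  refine Primrec.option_bind (Primrec.list_head?.comp hseg) ?_
  exact Primrec.ite (Primrec.eq.comp (hseg.comp Primrec.fst)
    (primrec_replicate.comp (hw.comp Primrec.fst) Primrec.snd))
    (Primrec.option_some.comp Primrec.snd) (Primrec.const none)

/-- Programs that output a slow string fast are compressible. -/
theorem IsOptimal.K_fast_le {U : PrefixTM} (hU : U.IsOptimal) :
    ∃ C, ∀ n T p t, t ≤ T → U.Halts p (U.slowString n T) t →
      U.K p + n ≤ U.K (List.replicate (Nat.pair n T) true) + p.length + C := by
  obtain ⟨lit, -, -, hlit, -⟩ := hU.exists_literal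
  obtain ⟨i, hi⟩ := hU.exists_index (H := fun a => Part.some (U.fastDecode a))
    U.primrec_fastDecode.to_comp.partrec
  -- The 1 pays for passing from a block to an aligned interval of half its length: the code word
  -- has length `|p| + 1 - n`.
  refine ⟨i.length + 1, fun n T p t ht hp => ?_⟩
  obtain ⟨q, hq, hqlen⟩ := exists_shortest (hlit (List.replicate (Nat.pair n T) true))
  have hlen := hp.length_le
  obtain ⟨l, r, hlr⟩ := exists_fastPrograms_eq ht hp (by omega)
  obtain ⟨-, hcard⟩ := U.slowString_spec n T
  -- A program that halts within `T` steps scans at most `T + 1` squares. With inputs of length `T +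
  -- 2` its block has length at least 2 and can be halved.
  obtain ⟨k, hk⟩ := Nat.exists_eq_add_of_le (show p.length + 1 ≤ T + 2 by omega)
  rw [show T + 2 - p.length = k + 1 by omega] at hlr
  have hnT : n ≤ T + 2 := by
    refine (Nat.pow_le_pow_iff_right one_lt_two).1 (le_trans ?_ hcard)
    refine Nat.le_mul_of_pos_left _ ?_
    rw [hlr]
    simp only [List.length_append, List.length_replicate]
    have : 0 < 2 ^ (k + 1) := by positivity
    omega
  have hcard' : (U.fastPrograms (U.slowString n T) T).length ≤ 2 ^ (T + 2 - n) := by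
    refine Nat.le_of_mul_le_mul_right (c := 2 ^ n) ?_ (by positivity)
    rwa [← pow_add, Nat.sub_add_cancel hnT]
  rw [hlr] at hcard'
  obtain ⟨hkd, w, hw, hwp⟩ := exists_dyadicEntry hcard'
  rw [← hlr] at hwp
  have hdec : ∀ r, U.fastDecode (List.replicate (Nat.pair n T) true, r) =
      dyadicEntry (U.fastPrograms (U.slowString n T) T) (T + 2 - n) r := by
    intro r
    simp [fastDecode]
  -- The decoder stops at the first prefix of `w` whose interval is constant; the shortest such
  -- prefix replaces `w` and decodes to the same program.
  have hex : ∃ m, ∃ r z, r <+: w ∧ r.length = m ∧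
      dyadicEntry (U.fastPrograms (U.slowString n T) T) (T + 2 - n) r = some z :=
    ⟨_, w, p, List.prefix_rfl, rfl, hwp⟩
  classical
  obtain ⟨r₀, z, hr₀, hm, hz⟩ := Nat.find_spec hex
  have hmin := fun m (h : m < Nat.find hex) => Nat.find_min hex h
  rw [← hm] at hmin
  obtain rfl := dyadicEntry_of_isPrefix hwp hz hr₀ (by omega)
  have := K_le (hi q _ r₀ z hq (by rw [hdec, hz]; exact Part.mem_some _) fun r' hr' hne => by
    rw [hdec]
    cases h : dyadicEntry (U.fastPrograms (U.slowString n T) T) (T + 2 - n) r' with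
    | none => exact Part.mem_some _
    | some z' =>
      refine absurd ⟨r', z', hr'.trans hr₀, rfl, h⟩ (hmin _ ?_)
      refine lt_of_le_of_ne hr'.length_le fun e => hne (hr'.eq_of_length e))
  have := hr₀.length_le
  simp only [List.length_append] at *
  omega

end PrefixTM

/-! ### A bound beyond all computable functions, and logical depth -/

namespace PrefixTM

variable {U : PrefixTM}

/-- Shortest programs determine their outputs. Strings without a program are left out, since `K`
takes the default value 0 on them. -/
theorem finite_K_le {S : Set (List Bool)} (hS : ∀ x ∈ S, ∃ p, U.Computes p x) (k : ℕ) :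
    {x ∈ S | U.K x ≤ k}.Finite := by
  choose! P hP using fun x hx => exists_shortest (hS x hx).choose_spec
  refine Set.Finite.of_injOn (f := P) (t := {p | p.length ≤ k}) ?_ ?_
    (List.finite_length_le Bool k)
  · rintro x ⟨hx, hk⟩
    exact (hP x hx).2.trans_le hk
  · rintro x ⟨hx, -⟩ y ⟨hy, -⟩ h
    refine (hP x hx).1.unique ?_
    rw [h]
    exact (hP y hy).1

/-- A bound that grows faster than any computable function: the largest `T` such that the pair
`(n, T)` has complexity at most `n / 2`. -/
noncomputable def slowBound (U : PrefixTM) (n : ℕ) : ℕ :=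
  sSup {T | U.K (List.replicate (Nat.pair n T) true) ≤ n / 2}

theorem IsOptimal.bddAbove_slowBound (hU : U.IsOptimal) (n : ℕ) :
    BddAbove {T | U.K (List.replicate (Nat.pair n T) true) ≤ n / 2} := by
  obtain ⟨lit, -, -, hlit, -⟩ := hU.exists_literal
  refine Set.Finite.bddAbove (Set.Finite.of_injOn
    (f := fun T => List.replicate (Nat.pair n T) true) ?_ ?_
    (finite_K_le (U := U) (S := Set.univ) (fun x _ => ⟨_, hlit x⟩) (n / 2)))
  · intro T hT
    exact ⟨trivial, hT⟩
  · intro T _ T' _ h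
    have := congrArg List.length h
    simp only [List.length_replicate] at this
    exact (Nat.pair_eq_pair.1 this).2

/-- With `L = Nat.log 2 n` one has `n ≥ 2 ^ L ≥ (L / 2 + 1) ^ 2`, which beats any linear function of
`L`. -/
theorem eventually_log_le (A B : ℕ) :
    ∀ᶠ n in Filter.atTop, A * (Nat.log 2 n + 1) + B ≤ n / 2 := by
  refine Filter.eventually_atTop.2 ⟨2 ^ (2 * (4 * A + 2 * B + 2)), fun n hn => ?_⟩
  set D := 4 * A + 2 * B + 2 with hD
  have hl : 2 * D ≤ Nat.log 2 n := Nat.le_log_of_pow_le one_lt_two hn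
  have hn0 : n ≠ 0 := by rintro rfl; simp at hn
  have hpow : 2 ^ Nat.log 2 n ≤ n := Nat.pow_log_le_self 2 hn0
  generalize Nat.log 2 n = L at hl hpow
  have hh : L / 2 < 2 ^ (L / 2) := Nat.lt_two_pow_self
  have h₁ : (2 : ℕ) ^ (L / 2) * 2 ^ (L / 2) ≤ 2 ^ L := by
    rw [← pow_add]
    exact Nat.pow_le_pow_right two_pos (by omega)
  have h₂ : (L / 2 + 1) * (L / 2 + 1) ≤ 2 ^ (L / 2) * 2 ^ (L / 2) := Nat.mul_le_mul hh hh
  have h₃ : D * (L / 2 + 1) ≤ (L / 2 + 1) * (L / 2 + 1) :=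
    Nat.mul_le_mul_right _ (by omega)
  have h₄ : D * (L / 2 + 1) = 4 * A * (L / 2 + 1) + (2 * B + 2) * (L / 2 + 1) := by
    rw [hD]; ring
  have h₅ : A * (L + 1) ≤ A * (2 * (L / 2 + 1)) := Nat.mul_le_mul_left _ (by omega)
  have h₆ : A * (2 * (L / 2 + 1)) * 2 = 4 * A * (L / 2 + 1) := by ring
  have h₇ : 2 * B + 2 ≤ (2 * B + 2) * (L / 2 + 1) := Nat.le_mul_of_pos_right _ (by omega)
  omega

/-- The pair is computed from the binary digits of `n`, a string of length `O(log n)`. -/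
theorem IsOptimal.eventually_K_pair_le (hU : U.IsOptimal) {f : ℕ → ℕ} (hf : Computable f) :
    ∀ᶠ n in Filter.atTop, U.K (List.replicate (Nat.pair n (f n)) true) ≤ n / 2 := by
  obtain ⟨lit, C, -, hlit, hlen⟩ := hU.exists_literal
  have hF : Computable fun y => List.replicate (Nat.pair (val y) (f (val y))) true :=
    primrec_replicate_true.to_comp.comp (Primrec₂.natPair.to_comp.comp primrec_val.to_comp
      (hf.comp primrec_val.to_comp))
  obtain ⟨C', hC'⟩ := hU.K_map_le hF.partrec
  filter_upwards [eventually_log_le (1 + C) C', Filter.eventually_ge_atTop 2] with n hn hn2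
  obtain ⟨h₁, h₂⟩ := length_word_log n
  generalize word (Nat.log 2 n + 1) n = y at h₁ h₂
  have h₃ := hC' y _ (Part.mem_some _)
  simp only [h₂] at h₃
  have hlog : 1 ≤ Nat.log 2 n := Nat.log_pos one_lt_two hn2
  have h₄ := (K_le (hlit y)).trans (hlen y (by omega))
  have h₅ : C * Nat.log 2 y.length ≤ C * y.length := Nat.mul_le_mul_left _ (Nat.log_le_self _ _)
  rw [h₁] at h₄ h₅
  rw [add_mul] at hn
  omega

theorem IsOptimal.eventually_le_slowBound (hU : U.IsOptimal) {f : ℕ → ℕ} (hf : Computable f) :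
    ∀ᶠ n in Filter.atTop, f n ≤ U.slowBound n ∧
      U.K (List.replicate (Nat.pair n (U.slowBound n)) true) ≤ n / 2 := by
  filter_upwards [hU.eventually_K_pair_le hf] with n hn
  exact ⟨le_csSup (hU.bddAbove_slowBound n) hn,
    Nat.sSup_mem (s := {T | U.K (List.replicate (Nat.pair n T) true) ≤ n / 2}) ⟨_, hn⟩
      (hU.bddAbove_slowBound n)⟩

theorem depthTimes_mono {b b' : ℕ} (h : b ≤ b') (x : List Bool) :
    U.depthTimes b x ⊆ U.depthTimes b' x :=
  fun _ ⟨p, hp, ht⟩ => ⟨p, by omega, ht⟩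

theorem depth_le {b t : ℕ} {x p : List Bool} (h : U.Halts p x t) (hp : p.length ≤ U.K p + b) :
    U.depth b x ≤ t :=
  Nat.sInf_le ⟨p, hp, h⟩

theorem ShortestIncompressible.exists_halts {c : ℕ} (hc : U.ShortestIncompressible c)
    (x : List Bool) : ∃ p t, U.Halts p x t ∧ p.length = U.K x ∧ p.length ≤ U.K p + c := by
  obtain ⟨p, ⟨t, ht⟩, h₁, h₂⟩ := hc x
  exact ⟨p, t, ht, h₁, h₂⟩

theorem ShortestIncompressible.depth_mem {c : ℕ} (hc : U.ShortestIncompressible c)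
    (x : List Bool) : U.depth c x ∈ U.depthTimes c x := by
  obtain ⟨p, t, ht, -, h⟩ := hc.exists_halts x
  exact Nat.sInf_mem ⟨t, p, h, ht⟩

theorem ShortestIncompressible.depth_le_depth {c b : ℕ} (hc : U.ShortestIncompressible c)
    (h : c ≤ b) (x : List Bool) : U.depth b x ≤ U.depth c x :=
  Nat.sInf_le (depthTimes_mono h x (hc.depth_mem x))

/-- All gaps are bounded by the depth at significance `c`, so their supremum is attained. -/
theorem ShortestIncompressible.exists_max_gap {c : ℕ} (hc : U.ShortestIncompressible c)
    (x : List Bool) : ∃ j, c ≤ j ∧ ∀ i, c ≤ i →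
      U.depth i x - U.depth (i + 1) x ≤ U.depth j x - U.depth (j + 1) x := by
  let S : Set ℕ := {g | ∃ i, c ≤ i ∧ g = U.depth i x - U.depth (i + 1) x}
  have hb : BddAbove S := by
    refine ⟨U.depth c x, ?_⟩
    rintro _ ⟨i, hi, rfl⟩
    exact (Nat.sub_le _ _).trans (hc.depth_le_depth hi x)
  obtain ⟨j, hj, he⟩ := Nat.sSup_mem (s := S) ⟨_, c, le_rfl, rfl⟩ hb
  exact ⟨j, hj, fun i hi => he ▸ le_csSup hb ⟨i, hi, rfl⟩⟩

theorem bddAbove_times (U : PrefixTM) (n : ℕ) :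
    BddAbove {t | ∃ p y : List Bool, p.length ≤ n ∧ U.Halts p y t} := by
  refine Set.Finite.bddAbove (((List.finite_length_le Bool n).biUnion
    (t := fun p => {t | ∃ y, U.Halts p y t}) fun p _ => Set.Subsingleton.finite ?_).subset ?_)
  · rintro t ⟨y, ht⟩ t' ⟨y', ht'⟩
    exact (ht.unique ht').1
  · rintro t ⟨p, y, hp, ht⟩
    simp only [Set.mem_iUnion]
    exact ⟨p, hp, y, ht⟩

theorem le_BB {p y : List Bool} {t n : ℕ} (h : U.Halts p y t) (hp : p.length ≤ n) : t ≤ U.BB n :=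
  le_csSup (U.bddAbove_times n) ⟨p, y, hp, h⟩

/-- Telescoping sum; truncated subtraction does no harm to upper bounds of this kind. -/
theorem depth_le_add_mul_gap {c h : ℕ} {x : List Bool}
    (hgap : ∀ i, c ≤ i → U.depth i x - U.depth (i + 1) x ≤ h) (j : ℕ) :
    U.depth c x ≤ U.depth (c + j) x + j * h := by
  induction j with
  | zero => simp
  | succ j ih =>
    have := hgap (c + j) (by omega)
    rw [add_mul, ← add_assoc c]
    omega

/-- Slow strings, with the bound `slowBound`, are deep at every fixed significance. -/
theorem IsOptimal.eventually_lt_depth (hU : U.IsOptimal) {c : ℕ}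
    (hc : U.ShortestIncompressible c) : ∀ᶠ n in Filter.atTop,
      U.slowBound n < U.depth c (U.slowString n (U.slowBound n)) := by
  obtain ⟨C, hC⟩ := hU.K_fast_le
  filter_upwards [hU.eventually_le_slowBound (Computable.const 0),
    Filter.eventually_gt_atTop (2 * (c + C) + 2)] with n hn hlt
  obtain ⟨p, hp, ht⟩ := hc.depth_mem (U.slowString n (U.slowBound n))
  by_contra hle
  have := hC n _ p _ (not_lt.1 hle) ht
  have := hn.2
  omega

end PrefixTM

/-! ### The theorem -/

theorem corollary1 (U : PrefixTM) (hU : U.IsOptimal) :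
    (∃ c : ℕ, U.ShortestIncompressible c) ∧
    ∃ x : ℕ → List Bool,
      (∀ m, (x (m + 1)).length = (x m).length + 1) ∧
      ∀ c : ℕ, U.ShortestIncompressible c →
        ∃ (h iMax : ℕ → ℕ) (C : ℕ),
          (∀ m, c ≤ iMax m ∧
            iMax m + U.K (x m) < (x m).length + C * Nat.log 2 (x m).length) ∧
          (∀ m, h m = U.depth (iMax m) (x m) - U.depth (iMax m + 1) (x m)) ∧
          (∀ m, ∀ i, c ≤ i → U.depth i (x m) - U.depth (i + 1) (x m) ≤ h m) ∧
          (∀ f : ℕ → ℕ, Computable f → ∀ᶠ m in Filter.atTop, f m < h m) ∧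
          (∀ m, h m ≤ U.BB ((x m).length + C * Nat.log 2 (x m).length)) := by
  -- The strings do not depend on `c`. The shift by 2 makes all logarithms at least 1, so constants
  -- can be absorbed into the logarithmic term.
  refine ⟨hU.exists_shortestIncompressible, fun m => U.slowString (m + 2) (U.slowBound (m + 2)),
    fun m => by simp only [(U.slowString_spec _ _).1], fun c hc => ?_⟩
  obtain ⟨x, hx⟩ : ∃ x, x = fun m => U.slowString (m + 2) (U.slowBound (m + 2)) := ⟨_, rfl⟩
  have hlen : ∀ m, (x m).length = m + 2 := fun m => hx ▸ (U.slowString_spec _ _).1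
  have hdeep : ∀ᶠ m in Filter.atTop, U.slowBound (m + 2) < U.depth c (x m) := by
    rw [hx]
    exact (Filter.tendsto_add_atTop_nat 2).eventually (hU.eventually_lt_depth hc)
  rw [← hx]
  obtain ⟨lit, C₁, hprim, hlit, hlitlen⟩ := hU.exists_literal
  obtain ⟨g, hg, hgt⟩ := PrefixTM.exists_computable_time hprim hlit
  obtain ⟨C₂, hC₂⟩ := hU.K_output_le
  have hshallow : ∀ m i, (x m).length + C₁ * Nat.log 2 (x m).length + C₂ ≤ i + U.K (x m) →
      U.depth i (x m) ≤ g (m + 2) := by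
    intro m i hi
    obtain ⟨t, ht, hh⟩ := hgt (x m)
    rw [hlen] at ht
    refine (PrefixTM.depth_le hh ?_).trans ht
    have h₁ := hlitlen (x m) (by rw [hlen]; omega)
    have h₂ := hC₂ _ _ (hlit (x m))
    omega
  choose iMax hci hmax using fun m => hc.exists_max_gap (x m)
  obtain ⟨h, hh⟩ : ∃ h : ℕ → ℕ,
      ∀ m, h m = U.depth (iMax m) (x m) - U.depth (iMax m + 1) (x m) := ⟨_, fun _ => rfl⟩
  simp only [← hh] at hmax
  -- The extra summand `g (m + 2)` is what later places the maximal gap before the threshold.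
  have hlarge : ∀ f : ℕ → ℕ, Computable f → ∀ᶠ m in Filter.atTop, f m + g (m + 2) < h m := by
    intro f hf
    -- If all gaps were at most `f m + g n`, this would bound the depth at `c`: the final depth plus
    -- number of steps times gap, with the logarithm estimated by `n`.
    have hF : Computable fun n => g n + (n + C₁ * n + C₂) * (f (n - 2) + g n) := by
      have hadd := Primrec.nat_add.to_comp
      have hmul := Primrec.nat_mul.to_comp
      exact hadd.comp hg (hmul.comp
        (hadd.comp (hadd.comp Computable.id (hmul.comp (Computable.const C₁) Computable.id))
          (Computable.const C₂))
        (hadd.comp (hf.comp (Primrec.nat_sub.to_comp.comp Computable.id (Computable.const 2))) hg))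
    filter_upwards [hdeep,
      (Filter.tendsto_add_atTop_nat 2).eventually (hU.eventually_le_slowBound hF)] with m h₁ h₂
    by_contra! hle
    have h₃ := PrefixTM.depth_le_add_mul_gap (hmax m)
      ((x m).length + C₁ * Nat.log 2 (x m).length + C₂)
    have h₄ := hshallow m (c + ((x m).length + C₁ * Nat.log 2 (x m).length + C₂)) (by omega)
    have h₅ : ((x m).length + C₁ * Nat.log 2 (x m).length + C₂) * h m ≤
        (m + 2 + C₁ * (m + 2) + C₂) * (f m + g (m + 2)) := by
      rw [hlen]
      gcongr
      exact Nat.log_le_self _ _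
    have h₆ := h₂.1
    rw [Nat.add_sub_cancel] at h₆
    omega
  obtain ⟨M, hM⟩ := Filter.eventually_atTop.1 (hlarge _ (Computable.const 0))
  have hlog : ∀ m, 1 ≤ Nat.log 2 (x m).length := fun m =>
    Nat.log_pos one_lt_two (by rw [hlen]; omega)
  -- The sum takes care of the finitely many `m < M` for which the gap need not exceed `g (m + 2)`.
  refine ⟨h, iMax, C₁ + C₂ + ∑ m ∈ Finset.range M, (iMax m + U.K (x m)), fun m => ⟨hci m, ?_⟩, hh,
    hmax, fun f hf => (hlarge f hf).mono fun m hm => by omega, fun m => ?_⟩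
  · have h₁ := hlog m
    have h₂ := hlen m
    rw [add_mul, add_mul]
    rcases lt_or_ge m M with hm | hm
    · have h₃ : iMax m + U.K (x m) ≤ ∑ m ∈ Finset.range M, (iMax m + U.K (x m)) :=
        Finset.single_le_sum (f := fun m => iMax m + U.K (x m)) (fun _ _ => Nat.zero_le _)
          (Finset.mem_range.2 hm)
      have h₄ := Nat.le_mul_of_pos_right (∑ m ∈ Finset.range M, (iMax m + U.K (x m))) h₁
      omega
    -- Past the threshold the depth, and with it the gap, is at most `g (m + 2)`, against the choice
    -- of `M`.
    · by_contra! hle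
      have h₃ := hM m hm
      have h₄ : C₂ ≤ C₂ * Nat.log 2 (x m).length := Nat.le_mul_of_pos_right _ h₁
      have h₅ := hshallow m (iMax m) (by omega)
      have h₆ := hh m
      omega
  · obtain ⟨p, t, ht, hp, hpc⟩ := hc.exists_halts (x m)
    have h₁ : h m ≤ U.depth c (x m) := by
      rw [hh]
      exact (Nat.sub_le _ _).trans (hc.depth_le_depth (hci m) _)
    refine h₁.trans ((PrefixTM.depth_le ht hpc).trans (PrefixTM.le_BB ht ?_))
    rw [hp]
    have h₂ := (PrefixTM.K_le (hlit (x m))).trans (hlitlen (x m) (by rw [hlen]; omega))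
    rw [add_assoc, add_mul]
    omega
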